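/- Let $X$ be a finite quandle, that is, a finite set with a binary operation $*$ such that $x*x=x$, each map $\bullet\mapsto\bullet*x$ is bijective, and $(x*y)*z=(x*z)*(y*z)$. Let $A$ be an abelian group and let $\kappa\colon X\to A$ be a quandle $1$-cocycle, i.e. $\kappa(x*y)=\kappa(x)$ for all $x,y\in X$. Let $\sigma^\sharp\kappa\colon X^2\to A$, $\sigma^\sharp\kappa(x,y)=\kappa(x)-\kappa(y)$, be the quandle $2$-cocycle obtained by pulling $\kappa$ back along the shifting chain map $\sigma_n=(-1)^n\partial^0_n\colon C^Q_n(X)\to C^Q_{n-1}(X)$ of the quandle chain complex, where $\partial_n^0(x_1,\dots,x_n)=\sum_{i=1}^n(-1)^i(x_1,\dots,x_{i-1},x_{i+1},\dots,x_n)$. Let $L$ be an oriented classical link in $\mathbb{R}^3$ and $D$ a diagram of $L$, with normal vectors of arcs pointing to the left. The fundamental quandle $Q_D$ is generated by the arcs of $D$, with one relation $a_i*a_j=a_k$ for each crossing, where $a_j$ is the over arc and its normal vector points from the under arc $a_i$ to the under arc $a_k$. Let $\mathrm{As}(Q_D)$ be the group with generators the elements of $Q_D$ and relations $x*y=y^{-1}xy$.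 Each region of $D$ is regarded as an element of $\mathrm{As}(Q_D)$ through the unique map that sends the unbounded region to the identity and satisfies $r_1\cdot a=r_2$ whenever the normal vector of an arc $a$ points from $r_1$ to $r_2$. The fundamental class $[D]\in H_2^Q(Q_D)_{\mathrm{As}(Q_D)}$ (generalized quandle homology with coefficients in the right $\mathrm{As}(Q_D)$-set $\mathrm{As}(Q_D)$) is the class of $\sum_\tau\varepsilon(\tau)\,(r;x,y)$. Here the sum is over all crossings $\tau$ of $D$, $\varepsilon(\tau)$ is the sign of $\tau$, $r$ is the region at $\tau$ from which all normal vectors point away, $x$ is the under arc facing $r$, and $y$ is the over arc. For a quandle $2$-cocycle $\phi\colon X^2\to A$, the quandle cocycle invariant of $L$ is $$\Phi_\phi(L)=\sum_{c\colon Q_D\to X}\langle s^{y_0}_*c_*[D],[\phi]\rangle\in\mathbb{Z}[A],$$ where the sum is over all quandle homomorphisms $c$, the map $c_*\colon H_2^Q(Q_D)_{\mathrm{As}(Q_D)}\to H_2^Q(X)_{\mathrm{As}(X)}$ is induced by $c$, the map $s^{y_0}_*\colon H_2^Q(X)_{\mathrm{As}(X)}\to H_2^Q(X)_{\{y_0\}}=H_2^Q(X)$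 is induced by the map $\mathrm{As}(X)\to\{y_0\}$ to a point, and each value of the Kronecker product, which is an element of $A$, is read as a basis element of the group ring $\mathbb{Z}[A]$. Then, for every diagram $D$ of $L$, the invariant $\Phi_{\sigma^\sharp\kappa}(L)$ computed from $D$ is trivial, that is, $$\Phi_{\sigma^\sharp\kappa}(L)=|\mathrm{Col}_X(L)|\cdot 0_A\in\mathbb{Z}[A],$$ where $|\mathrm{Col}_X(L)|$ is the number of quandle homomorphisms $Q_D\to X$ and $0_A$ is the identity element of $A$, regarded as an element of $\mathbb{Z}[A]$. -/

import Mathlib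

open Set Filter Topology MulOpposite Quandles

universe u v w

/-! ### Quandles

Mathlib's `Quandle` is written with a left action; the right-handed operation `x * y`
of quandle theory is `y ◃ x`. -/

namespace QuandleLink

/-- The associated group `As(X) = ⟨ x (x ∈ X) | x * y = y⁻¹ x y ⟩`. -/
abbrev AssocGroup (X : Type u) [Quandle X] : Type u :=
  PresentedGroup {r : FreeGroup X | ∃ x y : X,
    r = FreeGroup.of (y ◃ x) *
      ((FreeGroup.of y)⁻¹ * FreeGroup.of x * FreeGroup.of y)⁻¹}

/-- The canonical map `X → As(X)`. -/
def toAs {X : Type u} [Quandle X] (x : X) : AssocGroup X := PresentedGroup.of x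

theorem toAs_act {X : Type u} [Quandle X] (x y : X) :
    toAs (y ◃ x) = (toAs y)⁻¹ * toAs x * toAs y := by
  have h : (PresentedGroup.mk {r : FreeGroup X | ∃ x y : X,
      r = FreeGroup.of (y ◃ x) *
        ((FreeGroup.of y)⁻¹ * FreeGroup.of x * FreeGroup.of y)⁻¹})
      (FreeGroup.of (y ◃ x) *
        ((FreeGroup.of y)⁻¹ * FreeGroup.of x * FreeGroup.of y)⁻¹) = 1 :=
    PresentedGroup.one_of_mem ⟨x, y, rfl⟩
  rw [map_mul, map_inv, mul_inv_eq_one] at h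
  exact h

/-- The group homomorphism `As(f) : As(Q) → As(X)` induced by a quandle homomorphism. -/
def AssocGroup.map {Q : Type v} {X : Type u} [Quandle Q] [Quandle X] (f : Q →◃ X) :
    AssocGroup Q →* AssocGroup X :=
  PresentedGroup.toGroup (f := fun x => toAs (f x)) (by
    rintro r ⟨x, y, rfl⟩
    simp [ShelfHom.map_act, toAs_act])

/-! ### Presented quandles -/

/-- Formal quandle words in the generators `S`. -/
inductive QTerm (S : Type u) : Type u
  | of : S → QTerm S
  | act : QTerm S → QTerm S → QTerm S
  | invAct : QTerm S → QTerm S → QTerm S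

/-- The smallest congruence on quandle words that contains the quandle axioms and
the given relations `R`. -/
inductive QTerm.Rel {S : Type u} (R : QTerm S → QTerm S → Prop) : QTerm S → QTerm S → Prop
  | refl (a) : Rel R a a
  | symm {a b} : Rel R a b → Rel R b a
  | trans {a b c} : Rel R a b → Rel R b c → Rel R a c
  | congr_act {a a' b b'} : Rel R a a' → Rel R b b' → Rel R (.act a b) (.act a' b')
  | congr_invAct {a a' b b'} : Rel R a a' → Rel R b b' → Rel R (.invAct a b) (.invAct a' b')
  | self_distrib (a b c) : Rel R (.act a (.act b c)) (.act (.act a b) (.act a c))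
  | left_inv (a b) : Rel R (.invAct a (.act a b)) b
  | right_inv (a b) : Rel R (.act a (.invAct a b)) b
  | fix (a) : Rel R (.act a a) a
  | of_rel {a b} : R a b → Rel R a b

/-- The setoid of `QTerm.Rel R`. -/
def QTerm.setoid {S : Type u} (R : QTerm S → QTerm S → Prop) : Setoid (QTerm S) where
  r := QTerm.Rel R
  iseqv := ⟨.refl, .symm, .trans⟩

/-- The quandle presented by generators `S` and relations `R`. -/
def PresentedQuandle {S : Type u} (R : QTerm S → QTerm S → Prop) : Type u :=
  Quotient (QTerm.setoid R)

instance {S : Type u} (R : QTerm S → QTerm S → Prop) : Quandle (PresentedQuandle R) where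
  act := Quotient.map₂ QTerm.act fun _ _ h _ _ h' => QTerm.Rel.congr_act h h'
  invAct := Quotient.map₂ QTerm.invAct fun _ _ h _ _ h' => QTerm.Rel.congr_invAct h h'
  self_distrib := by
    rintro ⟨a⟩ ⟨b⟩ ⟨c⟩
    exact Quotient.sound (QTerm.Rel.self_distrib a b c)
  left_inv := by
    rintro ⟨a⟩ ⟨b⟩
    exact Quotient.sound (QTerm.Rel.left_inv a b)
  right_inv := by
    rintro ⟨a⟩ ⟨b⟩
    exact Quotient.sound (QTerm.Rel.right_inv a b)
  fix := by
    rintro ⟨a⟩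
    exact Quotient.sound (QTerm.Rel.fix a)

/-- The generator `s` as an element of the presented quandle. -/
def PresentedQuandle.of {S : Type u} (R : QTerm S → QTerm S → Prop) (s : S) :
    PresentedQuandle R :=
  Quotient.mk (QTerm.setoid R) (QTerm.of s)

theorem PresentedQuandle.hom_ext {S : Type u} {R : QTerm S → QTerm S → Prop}
    {X : Type v} [Quandle X] {f g : PresentedQuandle R →◃ X}
    (h : ∀ s, f (.of R s) = g (.of R s)) : f = g := by
  apply ShelfHom.ext
  funext q
  obtain ⟨q, rfl⟩ := Quotient.exists_rep q
  induction q with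
  | of s => exact h s
  | act a b iha ihb =>
    have hf := f.map_act' (x := Quotient.mk (QTerm.setoid R) a)
      (y := Quotient.mk (QTerm.setoid R) b)
    have hg := g.map_act' (x := Quotient.mk (QTerm.setoid R) a)
      (y := Quotient.mk (QTerm.setoid R) b)
    rw [← iha, ← ihb, ← hf] at hg
    exact hg.symm
  | invAct a b iha ihb =>
    have key : ∀ k : PresentedQuandle R →◃ X, k.toFun (Quotient.mk _ (QTerm.invAct a b)) =
        k.toFun (Quotient.mk _ a) ◃⁻¹ k.toFun (Quotient.mk _ b) := by
      intro k
      rw [← Rack.left_cancel (k.toFun (Quotient.mk _ a)), Rack.right_inv]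
      exact (k.map_act' (x := Quotient.mk (QTerm.setoid R) a)
        (y := Quotient.mk (QTerm.setoid R) (QTerm.invAct a b))).symm.trans
        (congrArg k.toFun (Quotient.sound (QTerm.Rel.right_inv a b)))
    rw [key, key, iha, ihb]

/-! ### Generalized quandle homology

An `X`-set is a set `Y` with a right action of `As(X)`, that is, a
`MulAction (AssocGroup X)ᵐᵒᵖ Y`; `y · g` is `op g • y`. -/

/-- `C_n^R(X)_Y`, the free abelian group on `Y × Xⁿ`. -/
abbrev RackChain (X : Type u) (Y : Type v) (n : ℕ) : Type (max u v) :=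
  (Y × (Fin n → X)) →₀ ℤ

/-- The `i`-th face `(y; x₁, …, xₙ₊₁) ↦ (y; x₁, …, xᵢ₋₁, xᵢ₊₁, …, xₙ₊₁)`. -/
def face0 {X : Type u} {Y : Type v} {n : ℕ} (i : Fin (n + 1)) (g : Y × (Fin (n + 1) → X)) :
    Y × (Fin n → X) :=
  (g.1, fun j => g.2 (i.succAbove j))

/-- The `i`-th face
`(y; x₁, …, xₙ₊₁) ↦ (y · xᵢ; x₁ * xᵢ, …, xᵢ₋₁ * xᵢ, xᵢ₊₁, …, xₙ₊₁)`. -/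
def face1 {X : Type u} [Quandle X] {Y : Type v} [MulAction (AssocGroup X)ᵐᵒᵖ Y] {n : ℕ}
    (i : Fin (n + 1)) (g : Y × (Fin (n + 1) → X)) : Y × (Fin n → X) :=
  (op (toAs (g.2 i)) • g.1,
    fun j => if j.castSucc < i then g.2 i ◃ g.2 (i.succAbove j) else g.2 (i.succAbove j))

/-- `∂⁰ₙ₊₁` on rack chains. The indices of `Fin (n + 1)` start at `0`, so the sign of the
face `i` is `(-1) ^ (i + 1)`. -/
noncomputable def rackBoundary0 (X : Type u) (Y : Type v) (n : ℕ) :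
    RackChain X Y (n + 1) →ₗ[ℤ] RackChain X Y n :=
  Finsupp.linearCombination ℤ fun g =>
    ∑ i : Fin (n + 1), (-1 : ℤ) ^ (i.val + 1) • Finsupp.single (face0 i g) 1

/-- `∂¹ₙ₊₁` on rack chains. -/
noncomputable def rackBoundary1 (X : Type u) [Quandle X] (Y : Type v)
    [MulAction (AssocGroup X)ᵐᵒᵖ Y] (n : ℕ) :
    RackChain X Y (n + 1) →ₗ[ℤ] RackChain X Y n :=
  Finsupp.linearCombination ℤ fun g =>
    ∑ i : Fin (n + 1), (-1 : ℤ) ^ (i.val + 1) • Finsupp.single (face1 i g) 1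

/-- The tuple has two equal consecutive entries. -/
def IsDegenerate {X : Type u} {n : ℕ} (x : Fin n → X) : Prop :=
  ∃ i j : Fin n, j.val = i.val + 1 ∧ x i = x j

/-- `C_n^D(X)_Y`, the subgroup generated by the degenerate generators. -/
noncomputable def degenerateChain (X : Type u) (Y : Type v) (n : ℕ) : Submodule ℤ (RackChain X Y n) :=
  Submodule.span ℤ {z | ∃ (y : Y) (x : Fin n → X), IsDegenerate x ∧ z = Finsupp.single (y, x) 1}

/-- `C_n^Q(X)_Y = C_n^R(X)_Y / C_n^D(X)_Y`. -/
abbrev QuandleChain (X : Type u) (Y : Type v) (n : ℕ) : Type (max u v) :=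
  RackChain X Y n ⧸ degenerateChain X Y n

theorem sum_faces_mem {X : Type u} {Y : Type v} {n : ℕ} (F : Fin (n + 1) → Y × (Fin n → X))
    (a b : Fin (n + 1)) (hab : b.val = a.val + 1) (heq : F a = F b)
    (hdeg : ∀ i, i ≠ a → i ≠ b → IsDegenerate (F i).2) :
    ∑ i : Fin (n + 1), (-1 : ℤ) ^ (i.val + 1) • (Finsupp.single (F i) 1 : RackChain X Y n) ∈
      degenerateChain X Y n := by
  classical
  have hne : a ≠ b := by
    intro h
    rw [h] at hab
    omega
  rw [← Finset.add_sum_erase _ _ (Finset.mem_univ a),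
    ← Finset.add_sum_erase _ _ (Finset.mem_erase.2 ⟨hne.symm, Finset.mem_univ b⟩),
    ← add_assoc]
  refine Submodule.add_mem _ ?_ (Submodule.sum_mem _ ?_)
  · rw [heq, hab, pow_succ _ (a.val + 1), ← add_smul]
    simp
  · intro i hi
    rw [Finset.mem_erase, Finset.mem_erase] at hi
    exact Submodule.smul_mem _ _ (Submodule.subset_span
      ⟨(F i).1, (F i).2, hdeg i hi.2.1 hi.1, rfl⟩)

theorem succAbove_val {n : ℕ} (i : Fin (n + 1)) (j : Fin n) :
    (i.succAbove j).val = if j.val < i.val then j.val else j.val + 1 := by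
  simp only [Fin.succAbove, Fin.lt_def, Fin.val_castSucc]
  split_ifs <;> simp

theorem rackBoundary0_degenerate (X : Type u) (Y : Type v) (n : ℕ) :
    degenerateChain X Y (n + 1) ≤ (degenerateChain X Y n).comap (rackBoundary0 X Y n) := by
  refine Submodule.span_le.2 ?_
  rintro _ ⟨y, x, ⟨a, b, hab, hx⟩, rfl⟩
  simp only [rackBoundary0, Submodule.comap_coe, mem_preimage, Finsupp.linearCombination_single,
    one_smul, SetLike.mem_coe]
  refine sum_faces_mem (fun i => face0 i (y, x)) a b hab ?_ ?_
  · refine Prod.ext rfl (funext fun j => ?_)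
    simp only [face0]
    by_cases hj : j.val = a.val
    · rw [show a.succAbove j = b from Fin.ext (by rw [succAbove_val]; split_ifs <;> omega),
        show b.succAbove j = a from Fin.ext (by rw [succAbove_val]; split_ifs <;> omega), hx]
    · rw [show a.succAbove j = b.succAbove j from
        Fin.ext (by rw [succAbove_val, succAbove_val]; split_ifs <;> omega)]
  · intro i hia hib
    obtain ⟨p, hp⟩ := Fin.exists_succAbove_eq hia.symm
    obtain ⟨q, hq⟩ := Fin.exists_succAbove_eq hib.symm
    refine ⟨p, q, ?_, ?_⟩
    · have h1 := succAbove_val i p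
      have h2 := succAbove_val i q
      rw [hp] at h1
      rw [hq] at h2
      have h3 : a.val ≠ i.val := fun h => hia (Fin.ext h.symm)
      have h4 : b.val ≠ i.val := fun h => hib (Fin.ext h.symm)
      split_ifs at h1 h2 <;> omega
    · simp only [face0, hp, hq, hx]

theorem rackBoundary1_degenerate (X : Type u) [Quandle X] (Y : Type v)
    [MulAction (AssocGroup X)ᵐᵒᵖ Y] (n : ℕ) :
    degenerateChain X Y (n + 1) ≤ (degenerateChain X Y n).comap (rackBoundary1 X Y n) := by
  refine Submodule.span_le.2 ?_
  rintro _ ⟨y, x, ⟨a, b, hab, hx⟩, rfl⟩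
  simp only [rackBoundary1, Submodule.comap_coe, mem_preimage, Finsupp.linearCombination_single,
    one_smul, SetLike.mem_coe]
  refine sum_faces_mem (fun i => face1 i (y, x)) a b hab ?_ ?_
  · refine Prod.ext (by simp only [face1, hx]) (funext fun j => ?_)
    simp only [face1, Fin.lt_def, Fin.val_castSucc]
    by_cases hj : j.val = a.val
    · rw [show a.succAbove j = b from Fin.ext (by rw [succAbove_val]; split_ifs <;> omega),
        show b.succAbove j = a from Fin.ext (by rw [succAbove_val]; split_ifs <;> omega), hx,
        if_neg (by omega), if_pos (by omega), Quandle.fix]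
    · rw [show a.succAbove j = b.succAbove j from
        Fin.ext (by rw [succAbove_val, succAbove_val]; split_ifs <;> omega), hx]
      split_ifs <;> first | rfl | omega
  · intro i hia hib
    obtain ⟨p, hp⟩ := Fin.exists_succAbove_eq hia.symm
    obtain ⟨q, hq⟩ := Fin.exists_succAbove_eq hib.symm
    have h1 := succAbove_val i p
    have h2 := succAbove_val i q
    rw [hp] at h1
    rw [hq] at h2
    have h3 : a.val ≠ i.val := fun h => hia (Fin.ext h.symm)
    have h4 : b.val ≠ i.val := fun h => hib (Fin.ext h.symm)
    refine ⟨p, q, ?_, ?_⟩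
    · split_ifs at h1 h2 <;> omega
    · simp only [face1, hp, hq, hx, Fin.lt_def, Fin.val_castSucc]
      split_ifs at h1 h2 ⊢ <;> first | rfl | omega

/-- `∂⁰ₙ₊₁` on quandle chains. -/
noncomputable def boundary0 (X : Type u) (Y : Type v) (n : ℕ) :
    QuandleChain X Y (n + 1) →ₗ[ℤ] QuandleChain X Y n :=
  Submodule.mapQ _ _ (rackBoundary0 X Y n) (rackBoundary0_degenerate X Y n)

/-- `∂¹ₙ₊₁` on quandle chains. -/
noncomputable def boundary1 (X : Type u) [Quandle X] (Y : Type v)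
    [MulAction (AssocGroup X)ᵐᵒᵖ Y] (n : ℕ) :
    QuandleChain X Y (n + 1) →ₗ[ℤ] QuandleChain X Y n :=
  Submodule.mapQ _ _ (rackBoundary1 X Y n) (rackBoundary1_degenerate X Y n)

/-- The boundary `∂ₙ₊₁ = ∂⁰ₙ₊₁ - ∂¹ₙ₊₁` of the generalized quandle chain complex. -/
noncomputable def boundary (X : Type u) [Quandle X] (Y : Type v)
    [MulAction (AssocGroup X)ᵐᵒᵖ Y] (n : ℕ) :
    QuandleChain X Y (n + 1) →ₗ[ℤ] QuandleChain X Y n :=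
  boundary0 X Y n - boundary1 X Y n

/-- The generator `(y; x₁, …, xₙ)` of `C_n^Q(X)_Y`. -/
noncomputable def QuandleChain.gen {X : Type u} {Y : Type v} {n : ℕ} (y : Y) (x : Fin n → X) :
    QuandleChain X Y n :=
  Submodule.Quotient.mk (Finsupp.single (y, x) 1)

/-- `Cⁿ_Q(X; A)_Y = Hom(C_n^Q(X)_Y, A)`. For `Y = PUnit` and `n ≥ 1` this is `Cⁿ_Q(X; A)`. -/
abbrev QuandleCochain (X : Type u) (Y : Type v) (A : Type w) [AddCommGroup A] (n : ℕ) :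
    Type (max u v w) :=
  QuandleChain X Y n →ₗ[ℤ] A

/-- `f ∈ Zⁿ_Q(X; A)_Y`, that is, `f ∘ ∂ₙ₊₁ = 0`. -/
def IsCocycle {X : Type u} [Quandle X] {Y : Type v} [MulAction (AssocGroup X)ᵐᵒᵖ Y]
    {A : Type w} [AddCommGroup A] {n : ℕ} (f : QuandleCochain X Y A n) : Prop :=
  f ∘ₗ boundary X Y n = 0

/-- The shifting map `σₙ₊₁ = (-1)ⁿ⁺¹ ∂⁰ₙ₊₁ : C_{n+1}^Q(X) → C_n^Q(X)` (for `n ≥ 1`), where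
`C_n^Q(X)` is identified with the complex for the one-point `X`-set. -/
noncomputable def shift (X : Type u) (n : ℕ) :
    QuandleChain X PUnit.{1} (n + 1) →ₗ[ℤ] QuandleChain X PUnit.{1} n :=
  (-1 : ℤ) ^ (n + 1) • boundary0 X PUnit.{1} n

/-- The dual `σ^♯ f = f ∘ σₙ₊₁` of the shifting map. -/
noncomputable def coshift {X : Type u} {A : Type w} [AddCommGroup A] {n : ℕ}
    (f : QuandleCochain X PUnit.{1} A n) : QuandleCochain X PUnit.{1} A (n + 1) :=
  f ∘ₗ shift X n

/-- The map `(y; x₁, …, xₙ) ↦ (p y; f x₁, …, f xₙ)` on quandle chains. -/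
noncomputable def chainMap {Q : Type u} {X : Type v} {Y Z : Type*} (p : Y → Z) (f : Q → X)
    (n : ℕ) : QuandleChain Q Y n →ₗ[ℤ] QuandleChain X Z n :=
  Submodule.mapQ _ _ (Finsupp.lmapDomain ℤ ℤ fun g => (p g.1, fun i => f (g.2 i))) (by
    refine Submodule.span_le.2 ?_
    rintro _ ⟨y, x, ⟨a, b, hab, hx⟩, rfl⟩
    refine Submodule.subset_span ⟨p y, fun i => f (x i), ⟨a, b, hab, congrArg f hx⟩, ?_⟩
    simp)

/-- The chain map `f_♯ : C_n^Q(Q)_{As(Q)} → C_n^Q(X)_{As(X)}` of a quandle homomorphism. -/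
noncomputable def homChainMap {Q : Type u} {X : Type v} [Quandle Q] [Quandle X] (f : Q →◃ X)
    (n : ℕ) : QuandleChain Q (AssocGroup Q) n →ₗ[ℤ] QuandleChain X (AssocGroup X) n :=
  chainMap (AssocGroup.map f) f n

/-- The chain map `s^y_♯ : C_n^Q(X)_{As(X)} → C_n^Q(X)_Y` of the `X`-map `s^y(g) = y · g`. -/
noncomputable def orbitChainMap {X : Type u} [Quandle X] {Y : Type v}
    [MulAction (AssocGroup X)ᵐᵒᵖ Y] (y : Y) (n : ℕ) :
    QuandleChain X (AssocGroup X) n →ₗ[ℤ] QuandleChain X Y n :=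
  chainMap (fun g : AssocGroup X => op g • y) id n

/-! ### Germs of paths in a set with finitely many pieces removed -/

/-- A path which lies in `S` for all small positive times lies there in one component. -/
theorem exists_germ {α : Type*} [TopologicalSpace α] {S : Set α} {γ : ℝ → α}
    (hγ : Continuous γ) (hS : ∀ᶠ ε in 𝓝[>] (0 : ℝ), γ ε ∈ S) :
    ∃ a : ConnectedComponents S, ∀ᶠ ε in 𝓝[>] (0 : ℝ),
      ∃ h : γ ε ∈ S, ConnectedComponents.mk (⟨γ ε, h⟩ : S) = a := by
  obtain ⟨δ, hδ, hsub⟩ := mem_nhdsGT_iff_exists_Ioo_subset.1 hS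
  have hδ' : (0 : ℝ) < δ := hδ
  have hmem : δ / 2 ∈ Ioo (0 : ℝ) δ := ⟨by linarith, by linarith⟩
  refine ⟨ConnectedComponents.mk (⟨γ (δ / 2), hsub hmem⟩ : S), ?_⟩
  filter_upwards [Ioo_mem_nhdsGT hδ'] with ε hε
  refine ⟨hsub hε, ?_⟩
  let g : Ioo (0 : ℝ) δ → S := fun e => ⟨γ e, hsub e.2⟩
  have hg : Continuous g := by fun_prop
  have : PreconnectedSpace (Ioo (0 : ℝ) δ) := Subtype.preconnectedSpace isPreconnected_Ioo
  have hr : IsPreconnected (range g) := isPreconnected_range hg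
  rw [ConnectedComponents.coe_eq_coe']
  exact hr.subset_connectedComponent ⟨⟨δ / 2, hmem⟩, rfl⟩ ⟨⟨ε, hε⟩, rfl⟩

/-- The connected component of `S` in which the path `γ` lies for all small positive times. -/
noncomputable def germComponent {α : Type*} [TopologicalSpace α] (S : Set α) (γ : ℝ → α)
    (hγ : Continuous γ) (hS : ∀ᶠ ε in 𝓝[>] (0 : ℝ), γ ε ∈ S) : ConnectedComponents S :=
  (exists_germ hγ hS).choose

/-! ### Links and their diagrams

`ℝ³` is written as `(ℝ × ℝ) × ℝ`; the first projection is the projection to the plane of the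
diagram and the second one is the height. -/

/-- The determinant of two plane vectors; it is positive when `b` points to the left of `a`. -/
def det2 (a b : ℝ × ℝ) : ℝ := a.1 * b.2 - a.2 * b.1

/-- A diagram of an oriented classical link: the generic projection to the plane, with its
crossing information, of an embedded oriented closed polygon (with any finite number of
components) in `ℝ³`. The oriented edges run from `vert v` to `vert (next v)`; the components
are the cycles of the permutation `next`. -/
structure LinkDiagram where
  /-- the number of vertices -/
  n : ℕ
  /-- the next vertex along the orientation -/
  next : Equiv.Perm (Fin n)
  /-- the position of the vertices -/
  vert : Fin n → (ℝ × ℝ) × ℝ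
  /-- the polygon is embedded in `ℝ³` -/
  embedded : ∀ v w : Fin n, ∀ s ∈ Ico (0 : ℝ) 1, ∀ t ∈ Ico (0 : ℝ) 1,
    AffineMap.lineMap (vert v) (vert (next v)) s = AffineMap.lineMap (vert w) (vert (next w)) t →
      v = w ∧ s = t
  /-- the image of a vertex in the plane is the image of no other point -/
  vertex_simple : ∀ v w : Fin n, ∀ t ∈ Ico (0 : ℝ) 1,
    (vert v).1 = (AffineMap.lineMap (vert w) (vert (next w)) t : (ℝ × ℝ) × ℝ).1 →
      v = w ∧ t = 0
  /-- double points in the plane are transverse -/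
  transverse : ∀ v w : Fin n, ∀ s ∈ Ico (0 : ℝ) 1, ∀ t ∈ Ico (0 : ℝ) 1,
    (AffineMap.lineMap (vert v) (vert (next v)) s : (ℝ × ℝ) × ℝ).1 =
      (AffineMap.lineMap (vert w) (vert (next w)) t : (ℝ × ℝ) × ℝ).1 →
    ¬ (v = w ∧ s = t) →
      det2 ((vert (next v)).1 - (vert v).1) ((vert (next w)).1 - (vert w).1) ≠ 0
  /-- there are no triple points in the plane -/
  no_triple : ∀ u v w : Fin n, ∀ r ∈ Ico (0 : ℝ) 1, ∀ s ∈ Ico (0 : ℝ) 1, ∀ t ∈ Ico (0 : ℝ) 1,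
    (AffineMap.lineMap (vert u) (vert (next u)) r : (ℝ × ℝ) × ℝ).1 =
      (AffineMap.lineMap (vert v) (vert (next v)) s : (ℝ × ℝ) × ℝ).1 →
    (AffineMap.lineMap (vert v) (vert (next v)) s : (ℝ × ℝ) × ℝ).1 =
      (AffineMap.lineMap (vert w) (vert (next w)) t : (ℝ × ℝ) × ℝ).1 →
    (u = v ∧ r = s) ∨ (v = w ∧ s = t) ∨ (u = w ∧ r = t)

namespace LinkDiagram

variable (D : LinkDiagram)

/-- The point with parameter `t` on the edge (for `0 ≤ t ≤ 1`) that starts at the vertex `v`. -/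
noncomputable def pt (v : Fin D.n) (t : ℝ) : (ℝ × ℝ) × ℝ :=
  AffineMap.lineMap (D.vert v) (D.vert (D.next v)) t

/-- The direction in the plane of the edge that starts at `v`. -/
def dir (v : Fin D.n) : ℝ × ℝ := (D.vert (D.next v)).1 - (D.vert v).1

/-- The underlying set of the link in `ℝ³`. -/
def carrier : Set ((ℝ × ℝ) × ℝ) := {p | ∃ v, ∃ t ∈ Ico (0 : ℝ) 1, D.pt v t = p}

/-- The image of the link in the plane. -/
def shadow : Set (ℝ × ℝ) := Prod.fst '' D.carrier

/-- A crossing of the diagram. -/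
@[ext]
structure Crossing where
  /-- the edge of the lower strand -/
  lo : Fin D.n
  /-- the edge of the upper strand -/
  up : Fin D.n
  /-- the parameter of the crossing on the lower edge -/
  s : ℝ
  /-- the parameter of the crossing on the upper edge -/
  t : ℝ
  hs : s ∈ Ico (0 : ℝ) 1
  ht : t ∈ Ico (0 : ℝ) 1
  meet : (D.pt lo s).1 = (D.pt up t).1
  below : (D.pt lo s).2 < (D.pt up t).2

variable {D}

namespace Crossing

variable (τ : D.Crossing)

/-- The lower point of the link at the crossing. -/
noncomputable def underPt : (ℝ × ℝ) × ℝ := D.pt τ.lo τ.s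

/-- The upper point of the link at the crossing. -/
noncomputable def overPt : (ℝ × ℝ) × ℝ := D.pt τ.up τ.t

open Classical in
/-- The sign `ε(τ)` of the crossing: it is positive when the lower strand crosses the upper
one from right to left. -/
noncomputable def sign : ℤ := if 0 < det2 (D.dir τ.up) (D.dir τ.lo) then 1 else -1

end Crossing

theorem pt_fst (v : Fin D.n) (t : ℝ) : (D.pt v t).1 = (D.vert v).1 + t • D.dir v := by
  simp [pt, dir, AffineMap.lineMap_apply, add_comm]

theorem continuous_pt (v : Fin D.n) : Continuous (D.pt v) := by
  unfold pt
  fun_prop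

theorem Crossing.ne (τ : D.Crossing) : ¬ (τ.lo = τ.up ∧ τ.s = τ.t) := by
  rintro ⟨h1, h2⟩
  have := τ.below
  rw [h1, h2] at this
  exact lt_irrefl _ this

theorem Crossing.det_ne (τ : D.Crossing) : det2 (D.dir τ.up) (D.dir τ.lo) ≠ 0 := by
  have h := D.transverse τ.lo τ.up τ.s τ.hs τ.t τ.ht τ.meet τ.ne
  intro h0
  apply h
  simp only [det2, dir] at h0 ⊢
  linarith

theorem dir_ne (v : Fin D.n) : D.dir v ≠ 0 := by
  intro h
  have := D.vertex_simple v v (1 / 2) ⟨by norm_num, by norm_num⟩ (by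
    have := D.pt_fst v (1 / 2)
    rw [h, smul_zero, add_zero] at this
    exact this.symm)
  norm_num at this

theorem pt_injective (v : Fin D.n) : Function.Injective (D.pt v) := by
  intro s t h
  have h1 : (D.vert v).1 + s • D.dir v = (D.vert v).1 + t • D.dir v := by
    rw [← pt_fst, ← pt_fst, h]
  exact smul_left_injective ℝ (dir_ne v) (add_left_cancel h1)

instance : Finite D.Crossing := by
  refine Finite.of_injective (fun τ : D.Crossing => (τ.lo, τ.up)) ?_
  rintro ⟨e, f, s, t, hs, ht, hm, hb⟩ ⟨e', f', s', t', hs', ht', hm', hb'⟩ h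
  simp only [Prod.mk.injEq] at h
  obtain ⟨rfl, rfl⟩ := h
  have hd := Crossing.det_ne ⟨e, f, s, t, hs, ht, hm, hb⟩
  rw [pt_fst, pt_fst] at hm hm'
  simp only [det2] at hd
  have a1 := congrArg Prod.fst hm
  have a2 := congrArg Prod.snd hm
  have b1 := congrArg Prod.fst hm'
  have b2 := congrArg Prod.snd hm'
  simp only [Prod.fst_add, Prod.snd_add, Prod.smul_fst, Prod.smul_snd, smul_eq_mul] at a1 a2 b1 b2
  have e1 : (s - s') * (D.dir e).1 = (t - t') * (D.dir f).1 := by linarith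
  have e2 : (s - s') * (D.dir e).2 = (t - t') * (D.dir f).2 := by linarith
  have k1 : (s - s') * ((D.dir f).1 * (D.dir e).2 - (D.dir f).2 * (D.dir e).1) = 0 := by
    linear_combination (D.dir f).1 * e2 - (D.dir f).2 * e1
  have k2 : (t - t') * ((D.dir f).1 * (D.dir e).2 - (D.dir f).2 * (D.dir e).1) = 0 := by
    linear_combination (D.dir e).1 * e2 - (D.dir e).2 * e1
  have h1 : s = s' := by
    rcases mul_eq_zero.1 k1 with h | h
    · linarith
    · exact absurd h hd
  have h2 : t = t' := by
    rcases mul_eq_zero.1 k2 with h | h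
    · linarith
    · exact absurd h hd
  subst h1 h2
  rfl

variable (D) in
/-- The set of the lower points of the crossings. -/
def underSet : Set ((ℝ × ℝ) × ℝ) := range fun τ : D.Crossing => τ.underPt

variable (D) in
/-- The arcs of the diagram: the connected components of the link with the lower points of
all crossings removed. -/
abbrev Arc : Type := ConnectedComponents ↥(D.carrier \ D.underSet)

variable (D) in
/-- The regions of the diagram: the connected components of the complement of its image in the
plane. -/
abbrev Region : Type := ConnectedComponents ↥(D.shadowᶜ)

namespace Crossing

variable (τ : D.Crossing)

theorem overPt_mem : τ.overPt ∈ D.carrier \ D.underSet := by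
  refine ⟨⟨_, _, τ.ht, rfl⟩, ?_⟩
  rintro ⟨τ', h⟩
  obtain ⟨h1, h2⟩ := D.embedded _ _ _ τ'.hs _ τ.ht h
  rcases D.no_triple _ _ _ _ τ.hs _ τ.ht _ τ'.ht τ.meet (by
    have := τ'.meet
    rw [h1, h2] at this
    exact this) with h3 | h3 | h3
  · exact τ.ne h3
  · exact τ'.ne ⟨h1.trans h3.1, h2.trans h3.2⟩
  · have a := τ.below
    have b := τ'.below
    rw [h1, h2] at b
    rw [h3.1, h3.2] at a
    exact lt_asymm a b

/-- The upper arc at the crossing. -/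
noncomputable def overArc : D.Arc := ConnectedComponents.mk ⟨τ.overPt, τ.overPt_mem⟩

theorem eventually_under (d : ℝ) (hd : d ≠ 0) :
    ∀ᶠ ε in 𝓝[>] (0 : ℝ), D.pt τ.lo (τ.s + ε * d) ∈ D.carrier \ D.underSet := by
  have hs : 0 < τ.s := by
    refine lt_of_le_of_ne τ.hs.1 fun h => τ.ne ?_
    have hm := τ.meet
    rw [← h] at hm
    have := D.vertex_simple τ.lo τ.up τ.t τ.ht (by
      have h0 : D.pt τ.lo 0 = D.vert τ.lo := by simp [pt]
      rw [h0] at hm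
      exact hm)
    exact ⟨this.1, by rw [← h, this.2]⟩
  have hc : Tendsto (fun ε : ℝ => τ.s + ε * d) (𝓝[>] 0) (𝓝 τ.s) := by
    have : Continuous fun ε : ℝ => τ.s + ε * d := by fun_prop
    have h := (this.tendsto 0).mono_left (nhdsWithin_le_nhds (s := Ioi 0))
    simpa using h
  have h1 : ∀ᶠ ε in 𝓝[>] (0 : ℝ), τ.s + ε * d ∈ Ico (0 : ℝ) 1 :=
    hc.eventually (Ico_mem_nhds hs τ.hs.2)
  have hinj : Function.Injective fun ε : ℝ => D.pt τ.lo (τ.s + ε * d) := by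
    intro a b hab
    have := pt_injective _ hab
    exact mul_right_cancel₀ hd (add_left_cancel this)
  have hfin : ((fun ε : ℝ => D.pt τ.lo (τ.s + ε * d)) ⁻¹' D.underSet).Finite :=
    (finite_range _).preimage hinj.injOn
  have h2 : ∀ᶠ ε in 𝓝[>] (0 : ℝ), D.pt τ.lo (τ.s + ε * d) ∉ D.underSet := by
    have hcl := (hfin.subset (sdiff_subset (t := {(0 : ℝ)}))).isClosed
    have h0 := hcl.isOpen_compl.mem_nhds (x := (0 : ℝ)) (by simp)
    filter_upwards [nhdsWithin_le_nhds h0, self_mem_nhdsWithin] with ε hε hpos hmem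
    exact hε ⟨hmem, ne_of_gt hpos⟩
  filter_upwards [h1, h2] with ε ha hb
  exact ⟨⟨_, _, ha, rfl⟩, hb⟩

theorem sign_ne : (τ.sign : ℝ) ≠ 0 := by
  unfold sign
  split_ifs <;> simp

/-- The lower arc on the right side of the upper strand, which is the side from which the
normal vector of the upper arc (pointing to the left) points away. -/
noncomputable def sourceArc : D.Arc :=
  germComponent _ (fun ε => D.pt τ.lo (τ.s + ε * (-τ.sign : ℝ)))
    ((D.continuous_pt _).comp (by fun_prop)) (τ.eventually_under _ (neg_ne_zero.2 τ.sign_ne))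

/-- The lower arc on the left side of the upper strand, to which the normal vector of the
upper arc points. -/
noncomputable def targetArc : D.Arc :=
  germComponent _ (fun ε => D.pt τ.lo (τ.s + ε * (τ.sign : ℝ)))
    ((D.continuous_pt _).comp (by fun_prop)) (τ.eventually_under _ τ.sign_ne)

/-- A direction at the crossing that points to the right of both strands. -/
noncomputable def cornerDir : ℝ × ℝ := (τ.sign : ℝ) • (D.dir τ.up - D.dir τ.lo)

theorem det_cornerDir :
    det2 (D.dir τ.up) τ.cornerDir < 0 ∧ det2 (D.dir τ.lo) τ.cornerDir < 0 := by
  have h := τ.det_ne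
  unfold cornerDir sign
  split_ifs with hp
  · simp only [det2, Prod.smul_fst, Prod.smul_snd, Prod.fst_sub, Prod.snd_sub, smul_eq_mul,
      Int.cast_one] at hp ⊢
    constructor <;> nlinarith
  · have hp' := lt_of_le_of_ne (not_lt.1 hp) h
    simp only [det2, Prod.smul_fst, Prod.smul_snd, Prod.fst_sub, Prod.snd_sub, smul_eq_mul,
      Int.cast_neg, Int.cast_one] at hp' ⊢
    constructor <;> nlinarith

theorem eventually_corner :
    ∀ᶠ ε in 𝓝[>] (0 : ℝ), τ.overPt.1 + ε • τ.cornerDir ∈ D.shadowᶜ := by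
  have key : ∀ v : Fin D.n, ∀ᶠ ε in 𝓝[>] (0 : ℝ),
      ∀ t ∈ Ico (0 : ℝ) 1, (D.pt v t).1 ≠ τ.overPt.1 + ε • τ.cornerDir := by
    intro v
    by_cases hv : ∃ r ∈ Icc (0 : ℝ) 1, (D.pt v r).1 = τ.overPt.1
    · obtain ⟨r, hr, hrp⟩ := hv
      have hvd : det2 (D.dir v) τ.cornerDir < 0 := by
        rcases eq_or_lt_of_le hr.2 with h1 | h1
        · exfalso
          have hw : (D.vert (D.next v)).1 = (D.pt τ.up τ.t).1 := by
            rw [← overPt, ← hrp, h1]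
            simp [pt]
          have hw' : (D.vert (D.next v)).1 = (D.pt τ.lo τ.s).1 := by rw [hw, ← τ.meet]
          have a := D.vertex_simple _ _ _ τ.ht hw
          have b := D.vertex_simple _ _ _ τ.hs hw'
          exact τ.ne ⟨b.1.symm.trans a.1, b.2.trans a.2.symm⟩
        · rcases D.no_triple v τ.lo τ.up r ⟨hr.1, h1⟩ _ τ.hs _ τ.ht
            (hrp.trans τ.meet.symm) τ.meet with h | h | h
          · rw [h.1]; exact τ.det_cornerDir.2
          · exact absurd h τ.ne
          · rw [h.1]; exact τ.det_cornerDir.1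
      filter_upwards [self_mem_nhdsWithin] with ε hε t _ h
      have hε' : (0 : ℝ) < ε := hε
      rw [← hrp, pt_fst, pt_fst] at h
      have a1 := congrArg Prod.fst h
      have a2 := congrArg Prod.snd h
      simp only [Prod.fst_add, Prod.snd_add, Prod.smul_fst, Prod.smul_snd, smul_eq_mul] at a1 a2
      have : ε * det2 (D.dir v) τ.cornerDir = 0 := by
        simp only [det2]
        linear_combination (D.dir v).2 * a1 - (D.dir v).1 * a2
      rcases mul_eq_zero.1 this with h | h
      · exact hε'.ne' h
      · exact hvd.ne h
    · have hcomp : IsCompact ((fun t => (D.pt v t).1) '' Icc (0 : ℝ) 1) :=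
        isCompact_Icc.image (continuous_fst.comp (D.continuous_pt v))
      have hc : Tendsto (fun ε : ℝ => τ.overPt.1 + ε • τ.cornerDir) (𝓝[>] 0)
          (𝓝 τ.overPt.1) := by
        have : Continuous fun ε : ℝ => τ.overPt.1 + ε • τ.cornerDir := by fun_prop
        have h := (this.tendsto 0).mono_left (nhdsWithin_le_nhds (s := Ioi 0))
        simpa using h
      have h0 := hc.eventually (hcomp.isClosed.isOpen_compl.mem_nhds (x := τ.overPt.1) (by
        rintro ⟨r, hr, h⟩
        exact hv ⟨r, hr, h⟩))
      filter_upwards [h0] with ε hε t ht h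
      exact hε ⟨t, Ico_subset_Icc_self ht, h⟩
  filter_upwards [eventually_all.2 key] with ε hε
  rintro ⟨_, ⟨v, t, ht, rfl⟩, h⟩
  exact hε v t ht h

/-- The specified region of the crossing: the one from which the normal vectors of all arcs
facing it point away. -/
noncomputable def specifiedRegion : D.Region :=
  germComponent _ (fun ε => τ.overPt.1 + ε • τ.cornerDir) (by fun_prop) τ.eventually_corner

end Crossing

/-! ### The fundamental quandle -/

variable (D)

/-- The relation `a_i * a_j = a_k` of a crossing, where `a_j` is the upper arc and its normal
vector points from `a_i` to `a_k`. -/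
inductive CrossingRel : QTerm D.Arc → QTerm D.Arc → Prop
  | mk (τ : D.Crossing) : CrossingRel (.act (.of τ.overArc) (.of τ.sourceArc)) (.of τ.targetArc)

/-- The fundamental quandle `Q_D`. -/
abbrev FundQuandle : Type := PresentedQuandle D.CrossingRel

/-- The arc `a` as an element of the fundamental quandle. -/
def arcElt (a : D.Arc) : D.FundQuandle := PresentedQuandle.of D.CrossingRel a

instance : Finite D.Arc := by
  classical
  have hrep : ∀ p : ↥(D.carrier \ D.underSet), ∃ v, ∃ t ∈ Ico (0 : ℝ) 1, D.pt v t = p.1 :=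
    fun p => p.2.1
  choose e t ht hp using hrep
  let g : ↥(D.carrier \ D.underSet) → Fin D.n × Set D.Crossing := fun p =>
    (e p, {τ | τ.s < t p})
  have hg : ∀ p q, t p ≤ t q → g p = g q →
      ConnectedComponents.mk p = ConnectedComponents.mk q := by
    intro p q hle h
    simp only [g, Prod.mk.injEq] at h
    obtain ⟨h1, h2⟩ := h
    have hsub : ∀ r ∈ Icc (t p) (t q), D.pt (e p) r ∈ D.carrier \ D.underSet := by
      intro r hr
      have hr' : r ∈ Ico (0 : ℝ) 1 := ⟨(ht p).1.trans hr.1, hr.2.trans_lt (ht q).2⟩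
      refine ⟨⟨_, r, hr', rfl⟩, ?_⟩
      rintro ⟨τ, hτ⟩
      obtain ⟨k1, k2⟩ := D.embedded _ _ _ τ.hs _ hr' hτ
      have hq : τ.s ≠ t q := by
        intro hs
        refine q.2.2 ⟨τ, ?_⟩
        simp only [Crossing.underPt]
        rw [k1, hs, h1, hp]
      have hmem : τ ∈ {τ : D.Crossing | τ.s < t q} := lt_of_le_of_ne (k2 ▸ hr.2) hq
      rw [← h2] at hmem
      exact absurd hr.1 (not_le.2 (k2 ▸ hmem))
    let γ : Icc (t p) (t q) → ↥(D.carrier \ D.underSet) := fun r => ⟨D.pt (e p) r, hsub r r.2⟩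
    have hγ : Continuous γ := ((D.continuous_pt _).comp continuous_subtype_val).subtype_mk _
    have : PreconnectedSpace (Icc (t p) (t q)) := Subtype.preconnectedSpace isPreconnected_Icc
    have hr : IsPreconnected (range γ) := isPreconnected_range hγ
    rw [ConnectedComponents.coe_eq_coe']
    refine hr.subset_connectedComponent ⟨⟨t q, hle, le_rfl⟩, ?_⟩ ⟨⟨t p, le_rfl, hle⟩, ?_⟩
    · exact Subtype.ext (by simp only [γ]; rw [h1, hp])
    · exact Subtype.ext (by simp only [γ]; rw [hp])
  refine Finite.of_injective (fun a : D.Arc => g a.out) ?_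
  intro a b hab
  have ha : ConnectedComponents.mk a.out = a := Quotient.out_eq a
  have hb : ConnectedComponents.mk b.out = b := Quotient.out_eq b
  rw [← ha, ← hb]
  rcases le_total (t a.out) (t b.out) with h | h
  · exact hg _ _ h hab
  · exact (hg _ _ h hab.symm).symm

/-- A finite quandle has finitely many colorings of the diagram. -/
instance {X : Type u} [Quandle X] [Finite X] : Finite (D.FundQuandle →◃ X) :=
  Finite.of_injective (fun c : D.FundQuandle →◃ X => fun a : D.Arc => c (D.arcElt a))
    fun _ _ h => PresentedQuandle.hom_ext fun a => congrFun h a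

/-! ### The fundamental class -/

/-- The normal vector of the edge that starts at `v`; it points to the left. -/
def normal (v : Fin D.n) : ℝ × ℝ := (-(D.dir v).2, (D.dir v).1)

/-- The point `p` of the plane lies in the region `r`. -/
def InRegion (p : ℝ × ℝ) (r : D.Region) : Prop :=
  ∃ h : p ∈ D.shadowᶜ, ConnectedComponents.mk (⟨p, h⟩ : ↥(D.shadowᶜ)) = r

/-- The conditions on the map `c^R` from regions to `As(Q_D)`: the unbounded region is sent
to `1`, and if the normal vector of an arc `a` points from `r₁` to `r₂` (at a point of `a`
which is neither a vertex nor a crossing), then `c^R(r₁) · a = c^R(r₂)`. -/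
def IsRegionLabelling (c : D.Region → AssocGroup D.FundQuandle) : Prop :=
  (∀ r, ¬ Bornology.IsBounded {p | D.InRegion p r} → c r = 1) ∧
  ∀ (v : Fin D.n) (t : ℝ) (_ : t ∈ Ioo (0 : ℝ) 1)
    (h : D.pt v t ∈ D.carrier \ D.underSet)
    (_ : ∀ q ∈ D.carrier, q.1 = (D.pt v t).1 → q = D.pt v t) (r₁ r₂ : D.Region),
    (∀ᶠ ε in 𝓝[>] (0 : ℝ), D.InRegion ((D.pt v t).1 - ε • D.normal v) r₁) →
    (∀ᶠ ε in 𝓝[>] (0 : ℝ), D.InRegion ((D.pt v t).1 + ε • D.normal v) r₂) →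
    c r₁ * toAs (D.arcElt (ConnectedComponents.mk ⟨D.pt v t, h⟩)) = c r₂

/-- The map `c^R : R_D → As(Q_D)`, the unique map with the property `IsRegionLabelling`. -/
noncomputable def regionLabel : D.Region → AssocGroup D.FundQuandle :=
  Classical.epsilon D.IsRegionLabelling

/-- The weight `B(τ) = ε(τ) (r; x, y)` of a crossing, where `r` is the specified region, `x` the
lower arc facing `r` and `y` the upper arc. -/
noncomputable def weight (τ : D.Crossing) :
    QuandleChain D.FundQuandle (AssocGroup D.FundQuandle) 2 :=
  τ.sign • QuandleChain.gen (D.regionLabel τ.specifiedRegion)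
    ![D.arcElt τ.sourceArc, D.arcElt τ.overArc]

/-- The cycle `|D| = ∑ B(τ)` that represents the fundamental class
`[D] ∈ H_2^Q(Q_D)_{As(Q_D)}`. -/
noncomputable def fundCycle : QuandleChain D.FundQuandle (AssocGroup D.FundQuandle) 2 :=
  ∑ᶠ τ : D.Crossing, D.weight τ

/-! ### Cocycle invariants -/

/-- The generalized quandle cocycle invariant
`Ψ_f^y(D) = ∑_{c : Q_D → X} ⟨s^y_* c_* [D], [f]⟩ ∈ ℤ[A]`. The Kronecker product of the classes
of a cycle `z` and of a cocycle `f` is `f z`. -/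
noncomputable def generalizedInvariant {X : Type u} [Quandle X] {Y : Type v}
    [MulAction (AssocGroup X)ᵐᵒᵖ Y] {A : Type w} [AddCommGroup A]
    (f : QuandleCochain X Y A 2) (y : Y) : AddMonoidAlgebra ℤ A :=
  ∑ᶠ c : D.FundQuandle →◃ X,
    AddMonoidAlgebra.single (f (orbitChainMap y 2 (homChainMap c 2 D.fundCycle))) 1

/-- The quandle cocycle invariant `Φ_f(D) = Ψ_f^{y₀}(D)` for the one-point `X`-set `{y₀}`. -/
noncomputable def cocycleInvariant {X : Type u} [Quandle X] {A : Type w} [AddCommGroup A]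
    (f : QuandleCochain X PUnit.{1} A 2) : AddMonoidAlgebra ℤ A :=
  D.generalizedInvariant f PUnit.unit

/-- The `X`-coloring number, the number of quandle homomorphisms `Q_D → X`. -/
noncomputable def coloringNumber (X : Type u) [Quandle X] : ℕ := Nat.card (D.FundQuandle →◃ X)

end LinkDiagram

/-! ### Links -/

/-- An oriented link in `ℝ³`: an embedding of finitely many circles `ℝ/ℤ`, each
oriented as `ℝ` is. -/
structure OrientedLink where
  /-- the number of components -/
  k : ℕ
  /-- the embedding -/
  toFun : Fin k × AddCircle (1 : ℝ) → (ℝ × ℝ) × ℝ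
  continuous_toFun : Continuous toFun
  injective_toFun : Function.Injective toFun

/-- `D` is a diagram of the link `L`: an ambient isotopy `H` of `ℝ³` carries `L`, with its
orientation, to the polygonal link of which `D` is the projection. -/
def LinkDiagram.Represents (D : LinkDiagram) (L : OrientedLink) : Prop :=
  ∃ H : unitInterval → ((ℝ × ℝ) × ℝ) ≃ₜ ((ℝ × ℝ) × ℝ),
    Continuous (fun p : unitInterval × ((ℝ × ℝ) × ℝ) => H p.1 p.2) ∧
    (∀ p, H 0 p = p) ∧
    range (fun x => H 1 (L.toFun x)) = D.carrier ∧
    ∀ (i : Fin L.k) (θ : AddCircle (1 : ℝ)) (v : Fin D.n), ∀ t ∈ Ioo (0 : ℝ) 1,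
      H 1 (L.toFun (i, θ)) = D.pt v t →
      ∀ᶠ ε in 𝓝[>] (0 : ℝ), ∃ t' ∈ Ioo t 1,
        H 1 (L.toFun (i, θ + ((ε : ℝ) : AddCircle (1 : ℝ)))) = D.pt v t'

end QuandleLink

/-! A colouring `c` evaluates the shifted cocycle to the sum of `ε(τ) (κ(c x) - κ(c y))` over the
crossings, with `x` the lower and `y` the upper arc; the region labels play no role
(`coshift_fundCycle`). Because `κ(x * y) = κ(x)`, the function `κ ∘ c` does not change when the link
passes under a crossing, so it is a function `K` on the components (`source_act_cochainValue`,
`exists_component_value`). Grouping the sum by the values of `K`, the coefficient of a value `a` is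
the total sign of the crossings where the sublink `K = a` is below, minus the total sign of those
where it is above. This vanishes: self-crossings cancel, and for the others it is the symmetry of
the linking number (`sum_sign_smul_sub`, `sum_sign_lo_eq_sum_sign_up`). Every colouring therefore
contributes `0_A`.

The symmetry is proved by a winding argument in the plane. For a sublink `C`, consider `e - f` with
`e` on `C` and `f` on its complement. The domain is a union of tori, cut into rectangles by pairs of
edges. Around the boundary of one rectangle `e - f` turns by `2π` times the signed number of zeros
inside, that is, of crossings of the two edges (`boundaryAngle_vertC`). Summed over all rectangles,
the sides cancel in pairs because the tori are closed (`sum_crossingNumber`). -/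

/-! ### Turning angle of the difference of two segments in the complex plane. -/

/-- Both arguments lie in `(-π/2, π/2)`, so their difference stays in the principal range and no
multiple of `2π` appears. -/
theorem Complex.arg_div_of_re_pos {x y : ℂ} (hx : 0 < x.re) (hy : 0 < y.re) :
    arg (x / y) = arg x - arg y := by
  have hx0 : x ≠ 0 := by rintro rfl; simp at hx
  have hy0 : y ≠ 0 := by rintro rfl; simp at hy
  have h1 := abs_lt.1 (Complex.abs_arg_lt_pi_div_two_iff.2 (Or.inl hx))
  have h2 := abs_lt.1 (Complex.abs_arg_lt_pi_div_two_iff.2 (Or.inl hy))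
  have h3 := Complex.arg_div_coe_angle hx0 hy0
  rw [← Complex.arg_coe_angle_toReal_eq_arg, h3, ← Real.Angle.coe_sub,
    Real.Angle.toReal_coe_eq_self_iff]
  constructor <;> linarith [h1.1, h1.2, h2.1, h2.2]

/-- The cross product of `y` and `x` is `|y|²` times the imaginary part of `x / y`, so its sign
tells the half plane of the quotient. -/
theorem Complex.arg_div_mem_Ioo {x y : ℂ} (h : 0 < y.re * x.im - y.im * x.re) :
    arg (x / y) ∈ Ioo 0 Real.pi := by
  have hy : 0 < Complex.normSq y := Complex.normSq_pos.2 (by rintro rfl; simp at h)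
  have him : 0 < (x / y).im := by
    rw [Complex.div_im, ← sub_div]
    exact div_pos (by linarith) hy
  have h1 := Complex.arg_nonneg_iff.2 him.le
  refine ⟨lt_of_le_of_ne h1 fun h0 => ?_, lt_of_le_of_ne (Complex.arg_le_pi _) fun h0 => ?_⟩
  · exact him.ne' (Complex.arg_eq_zero_iff.1 h0.symm).2
  · exact him.ne' (Complex.arg_eq_pi_iff.1 h0).2

theorem Complex.arg_div_mem_Ioo_neg {x y : ℂ} (h : y.re * x.im - y.im * x.re < 0) :
    arg (x / y) ∈ Ioo (-Real.pi) 0 := by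
  have hy : 0 < Complex.normSq y := Complex.normSq_pos.2 (by rintro rfl; simp at h)
  refine ⟨Complex.neg_pi_lt_arg _, Complex.arg_neg_iff.2 ?_⟩
  rw [Complex.div_im, ← sub_div]
  exact div_neg_of_neg_of_pos (by linarith) hy

/-- The total angle swept by `e - f` when `(e, f)` runs around the boundary of the product of
the segments `[a, b]` and `[c, d]`. -/
noncomputable def boundaryAngle (a b c d : ℂ) : ℝ :=
  Complex.arg ((b - c) / (a - c)) - Complex.arg ((b - d) / (a - d)) +
    (Complex.arg ((b - d) / (b - c)) - Complex.arg ((a - d) / (a - c)))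

/-- Modulo `2π` the argument of a quotient is a difference of arguments, and each corner of the
rectangle then occurs twice with opposite signs. -/
theorem boundaryAngle_eq_int {a b c d : ℂ} (hac : a ≠ c) (hbc : b ≠ c) (had : a ≠ d)
    (hbd : b ≠ d) : ∃ k : ℤ, boundaryAngle a b c d = k * (2 * Real.pi) := by
  rw [← sub_ne_zero] at hac hbc had hbd
  have h : ((boundaryAngle a b c d : ℝ) : Real.Angle) = 0 := by
    simp only [boundaryAngle, Real.Angle.coe_add, Real.Angle.coe_sub]
    rw [Complex.arg_div_coe_angle hbc hac, Complex.arg_div_coe_angle hbd had,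
      Complex.arg_div_coe_angle hbd hbc, Complex.arg_div_coe_angle had hac]
    abel
  obtain ⟨k, hk⟩ := Real.Angle.coe_eq_zero_iff.1 h
  exact ⟨k, by rw [← hk, zsmul_eq_mul]⟩

/-- Hahn–Banach separates `s` from `0` by a real functional, and every such functional on `ℂ` is `z
↦ Re (w z)`. Multiplication by `w` thus moves `s` into the right half plane. -/
theorem exists_halfPlane {s : Set ℂ} (hs : Convex ℝ s) (hc : IsCompact s) (h0 : (0 : ℂ) ∉ s) :
    ∃ w : ℂ, w ≠ 0 ∧ ∀ z ∈ s, 0 < (w * z).re := by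
  obtain ⟨f, u, hu, hf⟩ := geometric_hahn_banach_point_closed hs hc.isClosed h0
  rw [map_zero] at hu
  have key : ∀ z : ℂ, ((⟨f 1, -f Complex.I⟩ : ℂ) * z).re = f z := by
    intro z
    have hz : z = z.re • (1 : ℂ) + z.im • Complex.I := by
      apply Complex.ext <;> simp
    conv_rhs => rw [hz, map_add, map_smul, map_smul]
    simp only [Complex.mul_re, smul_eq_mul]
    ring
  by_cases hw : (⟨f 1, -f Complex.I⟩ : ℂ) = 0
  -- If `w = 0`, the functional is zero and strict separation leaves no point in `s`; any nonzero
  -- `w` will do.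
  · refine ⟨1, one_ne_zero, fun z hz => absurd (hu.trans (hf z hz)) ?_⟩
    rw [← key z, hw]
    simp
  · exact ⟨_, hw, fun z hz => by rw [key]; exact hu.trans (hf z hz)⟩

open scoped Pointwise in
-- The differences `x - y` form a compact convex set that misses `0`. After a rotation into the
-- right half plane, `arg` is additive on quotients without any correction, so the four terms cancel
-- exactly and not just modulo `2π`.
theorem boundaryAngle_eq_zero {a b c d : ℂ}
    (h : ∀ x ∈ segment ℝ a b, ∀ y ∈ segment ℝ c d, x ≠ y) : boundaryAngle a b c d = 0 := by
  have hconv : Convex ℝ (segment ℝ a b - segment ℝ c d) :=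
    (convex_segment a b).sub (convex_segment c d)
  have hcomp : IsCompact (segment ℝ a b - segment ℝ c d) := by
    have hseg : ∀ a b : ℂ, IsCompact (segment ℝ a b) := fun a b => by
      rw [segment_eq_image_lineMap]
      exact isCompact_Icc.image AffineMap.lineMap_continuous
    rw [sub_eq_add_neg]
    exact (hseg a b).add (hseg c d).neg
  obtain ⟨w, hw, hpos⟩ := exists_halfPlane hconv hcomp (by
    rintro ⟨x, hx, y, hy, hxy⟩
    exact h x hx y hy (sub_eq_zero.1 hxy))
  have key : ∀ x ∈ ({a, b} : Set ℂ), ∀ y ∈ ({c, d} : Set ℂ), ∀ x' ∈ ({a, b} : Set ℂ),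
      ∀ y' ∈ ({c, d} : Set ℂ), Complex.arg ((x - y) / (x' - y')) =
        Complex.arg (w * (x - y)) - Complex.arg (w * (x' - y')) := by
    have hmem : ∀ a b : ℂ, ∀ x ∈ ({a, b} : Set ℂ), x ∈ segment ℝ a b := by
      rintro a b x (rfl | rfl)
      · exact left_mem_segment ℝ _ _
      · exact right_mem_segment ℝ _ _
    intro x hx y hy x' hx' y' hy'
    rw [← Complex.arg_div_of_re_pos (hpos _ (Set.sub_mem_sub (hmem _ _ _ hx) (hmem _ _ _ hy)))
      (hpos _ (Set.sub_mem_sub (hmem _ _ _ hx') (hmem _ _ _ hy'))), mul_div_mul_left _ _ hw]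
  unfold boundaryAngle
  rw [key b (by simp) c (by simp) a (by simp) c (by simp),
    key b (by simp) d (by simp) a (by simp) d (by simp),
    key b (by simp) d (by simp) b (by simp) c (by simp),
    key a (by simp) d (by simp) a (by simp) c (by simp)]
  ring

/-- The differences fill a parallelogram with corners `a - c`, `b - c`, `b - d`, `a - d`, signed
area `±δ`, in which `0` has coordinates `(s, t)`. The formulas are the cross products of the two
ends of each side. -/
theorem cross_of_lineMap_eq {a b c d : ℂ} {s t : ℝ}
    (h : (AffineMap.lineMap a b s : ℂ) = AffineMap.lineMap c d t) {δ : ℝ}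
    (hδ : δ = (d - c).re * (b - a).im - (d - c).im * (b - a).re) :
    (a - c).re * (b - c).im - (a - c).im * (b - c).re = t * δ ∧
    (a - d).re * (b - d).im - (a - d).im * (b - d).re = -((1 - t) * δ) ∧
    (b - c).re * (b - d).im - (b - c).im * (b - d).re = (1 - s) * δ ∧
    (a - c).re * (a - d).im - (a - c).im * (a - d).re = -(s * δ) := by
  have h1 := congrArg Complex.re h
  have h2 := congrArg Complex.im h
  simp only [AffineMap.lineMap_apply, vsub_eq_sub, vadd_eq_add, Complex.add_re, Complex.smul_re,
    Complex.sub_re, smul_eq_mul, Complex.add_im, Complex.smul_im, Complex.sub_im] at h1 h2 hδ ⊢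
  subst hδ
  refine ⟨?_, ?_, ?_, ?_⟩
  · linear_combination (b.im - a.im) * h1 - (b.re - a.re) * h2
  · linear_combination (b.im - a.im) * h1 - (b.re - a.re) * h2
  · linear_combination (-(d.im - c.im)) * h1 + (d.re - c.re) * h2
  · linear_combination (-(d.im - c.im)) * h1 + (d.re - c.re) * h2

/-- Seen from the interior point `0`, each side of the parallelogram subtends an angle less than
`π`, and all four turn the same way. The total is a multiple of `2π` strictly between `0` and `±4π`.
-/
theorem boundaryAngle_of_lineMap_eq {a b c d : ℂ} {s t : ℝ} (hs : s ∈ Ioo (0 : ℝ) 1)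
    (ht : t ∈ Ioo (0 : ℝ) 1) (h : (AffineMap.lineMap a b s : ℂ) = AffineMap.lineMap c d t)
    (hδ : (d - c).re * (b - a).im - (d - c).im * (b - a).re ≠ 0) :
    boundaryAngle a b c d =
      if 0 < (d - c).re * (b - a).im - (d - c).im * (b - a).re then 2 * Real.pi
      else -(2 * Real.pi) := by
  obtain ⟨h1, h2, h3, h4⟩ := cross_of_lineMap_eq h rfl
  generalize (d - c).re * (b - a).im - (d - c).im * (b - a).re = δ at *
  have ht' : 0 < 1 - t := by linarith [ht.2]
  have hs' : 0 < 1 - s := by linarith [hs.2]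
  have hne : ∀ x y : ℂ, x.re * y.im - x.im * y.re ≠ 0 → x ≠ 0 ∧ y ≠ 0 := by
    intro x y hxy
    constructor <;> (rintro rfl; simp at hxy)
  obtain ⟨ka, kb⟩ := hne (a - c) (b - c) (by rw [h1]; exact mul_ne_zero ht.1.ne' hδ)
  obtain ⟨kc, kd⟩ := hne (a - d) (b - d)
    (by rw [h2]; exact neg_ne_zero.2 (mul_ne_zero ht'.ne' hδ))
  obtain ⟨k, hk⟩ := boundaryAngle_eq_int (sub_ne_zero.1 ka) (sub_ne_zero.1 kb)
    (sub_ne_zero.1 kc) (sub_ne_zero.1 kd)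
  have hpi := Real.pi_pos
  split_ifs with hp
  · have m1 := Complex.arg_div_mem_Ioo (h1 ▸ mul_pos ht.1 hp)
    have m2 := Complex.arg_div_mem_Ioo_neg (h2 ▸ neg_neg_of_pos (mul_pos ht' hp))
    have m3 := Complex.arg_div_mem_Ioo (h3 ▸ mul_pos hs' hp)
    have m4 := Complex.arg_div_mem_Ioo_neg (h4 ▸ neg_neg_of_pos (mul_pos hs.1 hp))
    have l1 : 0 < (k : ℝ) * (2 * Real.pi) := by
      rw [← hk, boundaryAngle]; linarith [m1.1, m2.2, m3.1, m4.2]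
    have l2 : (k : ℝ) * (2 * Real.pi) < 2 * (2 * Real.pi) := by
      rw [← hk, boundaryAngle]; linarith [m1.2, m2.1, m3.2, m4.1]
    have k1 : 0 < k := by exact_mod_cast pos_of_mul_pos_left l1 (by positivity)
    have k2 : k < 2 := by exact_mod_cast lt_of_mul_lt_mul_right l2 (by positivity)
    obtain rfl : k = 1 := by omega
    rw [hk]; simp
  · have hn : δ < 0 := lt_of_le_of_ne (not_lt.1 hp) hδ
    have m1 := Complex.arg_div_mem_Ioo_neg (h1 ▸ mul_neg_of_pos_of_neg ht.1 hn)
    have m2 := Complex.arg_div_mem_Ioo (h2 ▸ neg_pos.2 (mul_neg_of_pos_of_neg ht' hn))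
    have m3 := Complex.arg_div_mem_Ioo_neg (h3 ▸ mul_neg_of_pos_of_neg hs' hn)
    have m4 := Complex.arg_div_mem_Ioo (h4 ▸ neg_pos.2 (mul_neg_of_pos_of_neg hs.1 hn))
    have l1 : (k : ℝ) * (2 * Real.pi) < 0 * (2 * Real.pi) := by
      rw [← hk, boundaryAngle]; linarith [m1.2, m2.1, m3.2, m4.1]
    have l2 : (-2) * (2 * Real.pi) < (k : ℝ) * (2 * Real.pi) := by
      rw [← hk, boundaryAngle]; linarith [m1.1, m2.2, m3.1, m4.2]
    have k1 : k < 0 := by exact_mod_cast lt_of_mul_lt_mul_right l1 (by positivity)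
    have k2 : -2 < k := by exact_mod_cast lt_of_mul_lt_mul_right l2 (by positivity)
    obtain rfl : k = -1 := by omega
    rw [hk]; simp

/-! ### Signed crossings of pairs of edges and the symmetry of linking numbers. -/

namespace QuandleLink

namespace LinkDiagram

variable {D : LinkDiagram}

/-- This is Cramer's rule: the lines through two transverse edges have only one common point. -/
theorem eq_of_pt_fst_eq {v w : Fin D.n} {s t s' t' : ℝ}
    (hδ : det2 (D.dir w) (D.dir v) ≠ 0)
    (h : (D.pt v s).1 = (D.pt w t).1) (h' : (D.pt v s').1 = (D.pt w t').1) :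
    s = s' ∧ t = t' := by
  rw [pt_fst, pt_fst] at h h'
  simp only [det2] at hδ
  have a1 := congrArg Prod.fst h
  have a2 := congrArg Prod.snd h
  have b1 := congrArg Prod.fst h'
  have b2 := congrArg Prod.snd h'
  simp only [Prod.fst_add, Prod.snd_add, Prod.smul_fst, Prod.smul_snd, smul_eq_mul] at a1 a2 b1 b2
  constructor
  · refine sub_eq_zero.1 ((mul_eq_zero.1 (?_ : (s - s') * _ = 0)).resolve_right hδ)
    linear_combination (D.dir w).1 * (a2 - b2) - (D.dir w).2 * (a1 - b1)
  · refine sub_eq_zero.1 ((mul_eq_zero.1 (?_ : (t - t') * _ = 0)).resolve_right hδ)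
    linear_combination (D.dir v).1 * (a2 - b2) - (D.dir v).2 * (a1 - b1)

variable (D) in
/-- The position of a vertex in the plane of the diagram, as a complex number. -/
noncomputable def vertC (v : Fin D.n) : ℂ := ⟨(D.vert v).1.1, (D.vert v).1.2⟩

theorem lineMap_vertC (v : Fin D.n) (t : ℝ) :
    AffineMap.lineMap (D.vertC v) (D.vertC (D.next v)) t =
      (⟨(D.pt v t).1.1, (D.pt v t).1.2⟩ : ℂ) := by
  rw [pt_fst]
  apply Complex.ext <;> simp [vertC, dir, AffineMap.lineMap_apply, add_comm]

/-- In the plane, two edges that have no common end meet in interior points only. -/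
theorem mem_Ioo_of_pt_fst_eq {v w : Fin D.n} (h1 : v ≠ w) (h2 : D.next v ≠ w)
    (h3 : v ≠ D.next w) {s t : ℝ}
    (hs : s ∈ Icc (0 : ℝ) 1) (ht : t ∈ Icc (0 : ℝ) 1) (h : (D.pt v s).1 = (D.pt w t).1) :
    s ∈ Ioo (0 : ℝ) 1 := by
  have key : ∀ u, u ≠ w → u ≠ D.next w → (D.vert u).1 ≠ (D.pt w t).1 := by
    intro u hu hu' he
    -- `vertex_simple` speaks of parameters in `[0, 1)`, so the end of an edge is treated as the
    -- start of the next one.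
    rcases ht.2.eq_or_lt with rfl | ht1
    · exact hu' (D.vertex_simple u (D.next w) 0 (by simp) (by simpa [pt] using he)).1
    · exact hu (D.vertex_simple u w t ⟨ht.1, ht1⟩ he).1
  refine ⟨lt_of_le_of_ne hs.1 ?_, lt_of_le_of_ne hs.2 ?_⟩
  · rintro rfl
    exact key v h1 h3 (by simpa [pt] using h)
  · rintro rfl
    exact key _ h2 (fun h => h1 (D.next.injective h)) (by simpa [pt] using h)

open Classical in
/-- The signed number of crossings of two edges: a crossing counts with its sign if the first
edge is the lower one, and with the opposite sign if the first edge is the upper one. -/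
noncomputable def crossingNumber [Fintype D.Crossing] (v w : Fin D.n) : ℤ :=
  ∑ τ : D.Crossing, ((if τ.lo = v ∧ τ.up = w then τ.sign else 0) -
    if τ.lo = w ∧ τ.up = v then τ.sign else 0)

theorem crossingNumber_eq_zero [Fintype D.Crossing] {v w : Fin D.n}
    (h : ∀ s ∈ Ico (0 : ℝ) 1, ∀ t ∈ Ico (0 : ℝ) 1, (D.pt v s).1 ≠ (D.pt w t).1) :
    crossingNumber v w = 0 := by
  refine Finset.sum_eq_zero fun τ _ => ?_
  rw [if_neg, if_neg, sub_zero]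
  · rintro ⟨rfl, rfl⟩
    exact h _ τ.ht _ τ.hs τ.meet.symm
  · rintro ⟨rfl, rfl⟩
    exact h _ τ.hs _ τ.ht τ.meet

theorem det2_swap (a b : ℝ × ℝ) : det2 a b = -det2 b a := by
  simp only [det2]
  ring

open Classical in
-- Interchanging the heights of the strands reverses the crossing sign, and the sign convention of
-- `crossingNumber` reverses it again. The result depends on the planar picture alone, which is all
-- that the angle can see.
theorem crossingNumber_of_meet [Fintype D.Crossing] {v w : Fin D.n} (hvw : v ≠ w) {s t : ℝ}
    (hs : s ∈ Ico (0 : ℝ) 1) (ht : t ∈ Ico (0 : ℝ) 1) (h : (D.pt v s).1 = (D.pt w t).1) :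
    crossingNumber v w = if 0 < det2 (D.dir w) (D.dir v) then 1 else -1 := by
  have hδ : det2 (D.dir w) (D.dir v) ≠ 0 := by
    rw [det2_swap, neg_ne_zero]
    exact D.transverse v w s hs t ht h fun h => hvw h.1
  rcases lt_trichotomy (D.pt v s).2 (D.pt w t).2 with hlt | heq | hgt
  · let τ₀ : D.Crossing := ⟨v, w, s, t, hs, ht, h, hlt⟩
    rw [crossingNumber, Finset.sum_eq_single τ₀]
    · rw [if_pos ⟨rfl, rfl⟩, if_neg fun h => hvw h.1, sub_zero]
      rfl
    · intro τ _ hτ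
      rw [if_neg, if_neg, sub_zero]
      · rintro ⟨h1, h2⟩
        have hm := τ.meet
        have hb := τ.below
        rw [h1, h2] at hm hb
        obtain ⟨e1, e2⟩ := eq_of_pt_fst_eq hδ h hm.symm
        rw [← e1, ← e2] at hb
        exact lt_asymm hb hlt
      · rintro ⟨h1, h2⟩
        have hm := τ.meet
        rw [h1, h2] at hm
        obtain ⟨e1, e2⟩ := eq_of_pt_fst_eq hδ h hm
        exact hτ (Crossing.ext h1 h2 e1.symm e2.symm)
    · simp
  · exact absurd (D.embedded v w s hs t ht (Prod.ext h heq)).1 hvw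
  · let τ₀ : D.Crossing := ⟨w, v, t, s, ht, hs, h.symm, hgt⟩
    rw [crossingNumber, Finset.sum_eq_single τ₀]
    · rw [if_neg fun h => hvw h.2, if_pos ⟨rfl, rfl⟩, zero_sub]
      change -(if 0 < det2 (D.dir v) (D.dir w) then (1 : ℤ) else -1) = _
      rw [det2_swap (D.dir v)]
      rcases lt_or_gt_of_ne hδ with h0 | h0
      · rw [if_pos (by linarith), if_neg (by linarith)]
      · rw [if_neg (by linarith), if_pos h0, neg_neg]
    · intro τ _ hτ
      rw [if_neg, if_neg, sub_zero]
      · rintro ⟨h1, h2⟩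
        have hm := τ.meet
        rw [h1, h2] at hm
        obtain ⟨e1, e2⟩ := eq_of_pt_fst_eq hδ h hm.symm
        exact hτ (Crossing.ext h1 h2 e2.symm e1.symm)
      · rintro ⟨h1, h2⟩
        have hm := τ.meet
        have hb := τ.below
        rw [h1, h2] at hm hb
        obtain ⟨e1, e2⟩ := eq_of_pt_fst_eq hδ h hm
        rw [← e1, ← e2] at hb
        exact lt_asymm hb hgt
    · simp

/-- Without a common end, the two edges are either disjoint in the plane or meet transversely at an
interior point of both; these are the two cases in which the angle is known. -/
theorem boundaryAngle_vertC [Fintype D.Crossing] {v w : Fin D.n} (h1 : v ≠ w)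
    (h2 : D.next v ≠ w) (h3 : v ≠ D.next w) :
    boundaryAngle (D.vertC v) (D.vertC (D.next v)) (D.vertC w) (D.vertC (D.next w)) =
      crossingNumber v w * (2 * Real.pi) := by
  by_cases h : ∃ s ∈ Icc (0 : ℝ) 1, ∃ t ∈ Icc (0 : ℝ) 1, (D.pt v s).1 = (D.pt w t).1
  · obtain ⟨s, hs, t, ht, h⟩ := h
    have hs' := mem_Ioo_of_pt_fst_eq h1 h2 h3 hs ht h
    have ht' := mem_Ioo_of_pt_fst_eq h1.symm h3.symm h2.symm ht hs h.symm
    have hdet : (D.vertC (D.next w) - D.vertC w).re * (D.vertC (D.next v) - D.vertC v).im -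
        (D.vertC (D.next w) - D.vertC w).im * (D.vertC (D.next v) - D.vertC v).re =
          det2 (D.dir w) (D.dir v) := rfl
    have hδ : det2 (D.dir w) (D.dir v) ≠ 0 := by
      rw [det2_swap, neg_ne_zero]
      exact D.transverse v w s (Ioo_subset_Ico_self hs') t (Ioo_subset_Ico_self ht') h
        fun h => h1 h.1
    rw [boundaryAngle_of_lineMap_eq hs' ht' (by rw [lineMap_vertC, lineMap_vertC, h])
      (by rwa [hdet]), hdet,
      crossingNumber_of_meet h1 (Ioo_subset_Ico_self hs') (Ioo_subset_Ico_self ht') h]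
    split_ifs <;> simp
  · push Not at h
    rw [crossingNumber_eq_zero fun s hs t ht =>
      h s (Ico_subset_Icc_self hs) t (Ico_subset_Icc_self ht), boundaryAngle_eq_zero]
    · simp
    · simp only [segment_eq_image_lineMap]
      rintro _ ⟨s, hs, rfl⟩ _ ⟨t, ht, rfl⟩ he
      rw [lineMap_vertC, lineMap_vertC, Complex.mk.injEq] at he
      exact h s hs t ht (Prod.ext he.1 he.2)

open Classical in
-- Two terms of each `boundaryAngle` telescope as `w` runs along the complement of `C`, the other
-- two as `v` runs along `C`, since both sets are stable under `next`.
theorem sum_crossingNumber [Fintype D.Crossing] {C : Set (Fin D.n)}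
    (hC : ∀ v, D.next v ∈ C ↔ v ∈ C) :
    ∑ v with v ∈ C, ∑ w with w ∉ C, crossingNumber v w = 0 := by
  have key : ∑ v with v ∈ C, ∑ w with w ∉ C,
      boundaryAngle (D.vertC v) (D.vertC (D.next v)) (D.vertC w) (D.vertC (D.next w)) = 0 := by
    have tele : ∀ (P : Fin D.n → Prop) [DecidablePred P], (∀ v, P (D.next v) ↔ P v) → ∀ f : Fin D.n → ℝ,
        ∑ v with P v, f (D.next v) = ∑ v with P v, f v := by
      intro P _ hP f
      exact Finset.sum_equiv D.next (by simp [hP]) (fun _ _ => rfl)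
    simp only [boundaryAngle, Finset.sum_add_distrib]
    rw [Finset.sum_eq_zero, zero_add, Finset.sum_comm, Finset.sum_eq_zero]
    · intro w _
      rw [Finset.sum_sub_distrib, sub_eq_zero]
      exact tele (· ∈ C) hC fun v => Complex.arg ((D.vertC v - D.vertC (D.next w)) /
        (D.vertC v - D.vertC w))
    · intro v _
      rw [Finset.sum_sub_distrib, sub_eq_zero]
      exact (tele (· ∉ C) (fun v => not_congr (hC v)) fun w =>
        Complex.arg ((D.vertC (D.next v) - D.vertC w) / (D.vertC v - D.vertC w))).symm
  have h2 : (∑ v with v ∈ C, ∑ w with w ∉ C, (crossingNumber v w : ℝ)) * (2 * Real.pi) = 0 := by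
    rw [← key]
    simp only [Finset.sum_mul]
    refine Finset.sum_congr rfl fun v hv => Finset.sum_congr rfl fun w hw => ?_
    rw [Finset.mem_filter] at hv hw
    -- An edge of `C` and an edge outside `C` belong to different components, hence have no common
    -- end.
    rw [boundaryAngle_vertC]
    · rintro rfl
      exact hw.2 hv.2
    · rintro rfl
      exact hw.2 ((hC v).2 hv.2)
    · rintro rfl
      exact hw.2 ((hC w).1 hv.2)
  exact_mod_cast (mul_eq_zero.1 h2).resolve_right (by positivity)

open Classical in
/-- The symmetry of linking numbers: the crossings at which a sublink is the lower strand and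
those at which it is the upper strand have the same total sign. -/
theorem sum_sign_lo_eq_sum_sign_up [Fintype D.Crossing] {C : Set (Fin D.n)}
    (hC : ∀ v, D.next v ∈ C ↔ v ∈ C) :
    ∑ τ : D.Crossing with τ.lo ∈ C, τ.sign = ∑ τ : D.Crossing with τ.up ∈ C, τ.sign := by
  have h := sum_crossingNumber hC
  have h1 : ∀ v ∈ Finset.univ.filter (· ∈ C), ∑ w with w ∉ C, crossingNumber v w =
      ∑ τ : D.Crossing, ∑ w with w ∉ C, ((if τ.lo = v ∧ τ.up = w then τ.sign else 0) -
        if τ.lo = w ∧ τ.up = v then τ.sign else 0) := fun v _ => Finset.sum_comm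
  rw [Finset.sum_congr rfl h1, Finset.sum_comm] at h
  rw [← sub_eq_zero, Finset.sum_filter, Finset.sum_filter, ← Finset.sum_sub_distrib]
  refine Eq.trans ?_ h
  refine Finset.sum_congr rfl fun τ _ => ?_
  simp only [Finset.sum_sub_distrib, ite_and]
  -- Crossings with both strands or neither in `C` contribute `0` on both sides; only the mixed ones
  -- count.
  by_cases hl : τ.lo ∈ C <;> by_cases hu : τ.up ∈ C <;>
    simp [hl, hu, Finset.sum_ite_irrel]

end LinkDiagram
end QuandleLink

/-! ### From functions on arcs to functions on components. -/

namespace QuandleLink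

namespace LinkDiagram

variable {D : LinkDiagram}

theorem pt_mem_carrier (v : Fin D.n) {t : ℝ} (ht : t ∈ Icc (0 : ℝ) 1) : D.pt v t ∈ D.carrier := by
  rcases ht.2.eq_or_lt with rfl | h
  · exact ⟨D.next v, 0, by simp, by simp [pt]⟩
  · exact ⟨v, t, ⟨ht.1, h⟩, rfl⟩

namespace Crossing

variable (τ : D.Crossing)

theorem eventually_sourceArc : ∀ᶠ ε in 𝓝[>] (0 : ℝ),
    ∃ h : D.pt τ.lo (τ.s + ε * (-τ.sign : ℝ)) ∈ D.carrier \ D.underSet,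
      ConnectedComponents.mk (⟨_, h⟩ : ↥(D.carrier \ D.underSet)) = τ.sourceArc :=
  (exists_germ ((D.continuous_pt _).comp (by fun_prop))
    (τ.eventually_under _ (neg_ne_zero.2 τ.sign_ne))).choose_spec

theorem eventually_targetArc : ∀ᶠ ε in 𝓝[>] (0 : ℝ),
    ∃ h : D.pt τ.lo (τ.s + ε * (τ.sign : ℝ)) ∈ D.carrier \ D.underSet,
      ConnectedComponents.mk (⟨_, h⟩ : ↥(D.carrier \ D.underSet)) = τ.targetArc :=
  (exists_germ ((D.continuous_pt _).comp (by fun_prop))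
    (τ.eventually_under _ τ.sign_ne)).choose_spec

/-- Near the crossing, the lower strand lies in the two lower arcs. -/
theorem eventually_lower {P : D.Arc → Prop} (h1 : P τ.sourceArc) (h2 : P τ.targetArc) :
    ∀ᶠ t in 𝓝[≠] τ.s, ∃ h : D.pt τ.lo t ∈ D.carrier \ D.underSet,
      P (ConnectedComponents.mk ⟨_, h⟩) := by
  have key : ∀ {d : ℝ} {a : D.Arc}, P a → (∀ᶠ ε in 𝓝[>] (0 : ℝ),
      ∃ h : D.pt τ.lo (τ.s + ε * d) ∈ D.carrier \ D.underSet,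
        ConnectedComponents.mk (⟨_, h⟩ : ↥(D.carrier \ D.underSet)) = a) →
      ∀ᶠ ε in 𝓝[>] (0 : ℝ), ∃ h : D.pt τ.lo (τ.s + ε * d) ∈ D.carrier \ D.underSet,
        P (ConnectedComponents.mk ⟨_, h⟩) := by
    intro d a ha h
    filter_upwards [h] with ε ⟨h, he⟩
    exact ⟨h, he ▸ ha⟩
  have hs := key h1 τ.eventually_sourceArc
  have ht := key h2 τ.eventually_targetArc
  have hr : Tendsto (fun t => t - τ.s) (𝓝[>] τ.s) (𝓝[>] 0) := by
    refine tendsto_nhdsWithin_of_tendsto_nhds_of_eventually_within _ ?_ ?_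
    · have : Continuous fun t => t - τ.s := by fun_prop
      simpa using (this.tendsto τ.s).mono_left nhdsWithin_le_nhds
    · filter_upwards [self_mem_nhdsWithin] with t ht using sub_pos.2 (mem_Ioi.1 ht)
  have hl : Tendsto (fun t => τ.s - t) (𝓝[<] τ.s) (𝓝[>] 0) := by
    refine tendsto_nhdsWithin_of_tendsto_nhds_of_eventually_within _ ?_ ?_
    · have : Continuous fun t => τ.s - t := by fun_prop
      simpa using (this.tendsto τ.s).mono_left nhdsWithin_le_nhds
    · filter_upwards [self_mem_nhdsWithin] with t ht using sub_pos.2 (mem_Iio.1 ht)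
  have hsign : τ.sign = 1 ∨ τ.sign = -1 := by
    unfold sign
    split_ifs <;> simp
  rw [← Iio_union_Ioi, nhdsWithin_union, eventually_sup]
  -- The sign decides which lower arc comes first along the orientation: the source arc at a
  -- positive crossing, the target arc at a negative one.
  rcases hsign with h | h <;> rw [h] at hs ht
  · exact ⟨by simpa using hl.eventually hs, by simpa using hr.eventually ht⟩
  · exact ⟨by simpa using hl.eventually ht, by simpa using hr.eventually hs⟩

end Crossing

/-- Along an edge, the arc is locally constant away from the lower points of the crossings. -/
theorem eventually_arc_eq (v : Fin D.n) {t : ℝ} (h : D.pt v t ∉ D.underSet) :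
    ∀ᶠ t' in 𝓝 t, ∀ ht : t ∈ Icc (0 : ℝ) 1, t' ∈ Icc (0 : ℝ) 1 →
      ∃ h' : D.pt v t' ∈ D.carrier \ D.underSet,
        (ConnectedComponents.mk ⟨_, h'⟩ : D.Arc) =
          ConnectedComponents.mk ⟨_, pt_mem_carrier v ht, h⟩ := by
  have hfin : D.underSet.Finite := finite_range _
  obtain ⟨δ, hδ, hball⟩ := Metric.mem_nhds_iff.1
    ((D.continuous_pt v).continuousAt.preimage_mem_nhds (hfin.isClosed.isOpen_compl.mem_nhds h))
  filter_upwards [Metric.ball_mem_nhds t hδ] with t' ht' ht hI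
  -- The ball is cut down to `[0, 1]` because the line of the edge may leave the link beyond its
  -- ends.
  let S : Set ℝ := Metric.ball t δ ∩ Icc 0 1
  have hS : IsPreconnected S :=
    ((convex_ball t δ).inter (convex_Icc 0 1)).isPreconnected
  let γ : S → ↥(D.carrier \ D.underSet) := fun r =>
    ⟨D.pt v r, pt_mem_carrier v r.2.2, hball r.2.1⟩
  have hγ : Continuous γ := ((D.continuous_pt v).comp continuous_subtype_val).subtype_mk _
  have : PreconnectedSpace S := Subtype.preconnectedSpace hS
  have hr : IsPreconnected (range γ) := isPreconnected_range hγ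
  refine ⟨⟨pt_mem_carrier v hI, hball ht'⟩, ?_⟩
  rw [ConnectedComponents.coe_eq_coe']
  exact hr.subset_connectedComponent ⟨⟨t, Metric.mem_ball_self hδ, ht⟩, rfl⟩
    ⟨⟨t', ht', hI⟩, rfl⟩

open Classical in
/-- A function on the arcs that takes the same value on the two lower arcs of each crossing
takes one value on each edge. -/
theorem exists_edge_value {A : Type u} {k : D.Arc → A}
    (hk : ∀ τ : D.Crossing, k τ.sourceArc = k τ.targetArc) (v : Fin D.n) :
    ∃ a : A, (∀ t ∈ Icc (0 : ℝ) 1, ∀ h : D.pt v t ∈ D.carrier \ D.underSet,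
      k (ConnectedComponents.mk ⟨_, h⟩) = a) ∧
      ∀ τ : D.Crossing, τ.lo = v → k τ.sourceArc = a := by
  -- The gaps at the lower points are filled with the common value of the two adjacent arcs. The
  -- result is locally constant on the connected interval `[0, 1]`, hence constant.
  let g : Icc (0 : ℝ) 1 → A := fun t =>
    if h : D.pt v t ∈ D.underSet then k h.choose.sourceArc
    else k (ConnectedComponents.mk ⟨_, pt_mem_carrier v t.2, h⟩)
  have hunder : ∀ (t : Icc (0 : ℝ) 1) (h : D.pt v t ∈ D.underSet),
      h.choose.lo = v ∧ h.choose.s = t := by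
    intro t h
    have hp : D.pt h.choose.lo h.choose.s = D.pt v t := h.choose_spec
    -- A lower point at parameter `1` would be a vertex whose planar image is a double point, which
    -- `vertex_simple` forbids.
    rcases t.2.2.eq_or_lt with h1 | h1
    · exfalso
      have hw : D.pt h.choose.lo h.choose.s = D.vert (D.next v) := by
        rw [hp, h1]
        simp [pt]
      have h2 := (D.vertex_simple (D.next v) _ _ h.choose.hs (congrArg Prod.fst hw.symm)).2
      have h3 := (D.vertex_simple (D.next v) _ _ h.choose.ht
        ((congrArg Prod.fst hw.symm).trans h.choose.meet))
      have h4 := (D.vertex_simple (D.next v) _ _ h.choose.hs (congrArg Prod.fst hw.symm))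
      exact h.choose.ne ⟨h4.1.symm.trans h3.1, h4.2.trans h3.2.symm⟩
    · exact D.embedded _ _ _ h.choose.hs _ ⟨t.2.1, h1⟩ hp
  have hg : IsLocallyConstant g := by
    rw [IsLocallyConstant.iff_eventually_eq]
    intro t
    by_cases h : D.pt v t ∈ D.underSet
    · obtain ⟨hlo, hs⟩ := hunder t h
      have ev := h.choose.eventually_lower (P := fun a => k a = g t)
        (by simp only [g]; rw [dif_pos h]) (by simp only [g]; rw [dif_pos h, hk])
      rw [hlo, hs, eventually_nhdsWithin_iff] at ev
      filter_upwards [continuous_subtype_val.continuousAt.eventually ev] with t' ht'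
      by_cases he : t' = t
      · rw [he]
      · obtain ⟨h1, h2⟩ := ht' (fun h => he (Subtype.ext h))
        rw [← h2]
        simp only [g]
        rw [dif_neg h1.2]
    · filter_upwards [continuous_subtype_val.continuousAt.eventually (eventually_arc_eq v h)]
        with t' ht'
      obtain ⟨h1, h2⟩ := ht' t.2 t'.2
      simp only [g]
      rw [dif_neg h, dif_neg h1.2, h2]
  have : PreconnectedSpace (Icc (0 : ℝ) 1) := Subtype.preconnectedSpace isPreconnected_Icc
  have hconst : ∀ t, g t = g ⟨0, by simp⟩ := fun t => hg.apply_eq_of_preconnectedSpace _ _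
  refine ⟨g ⟨0, by simp⟩, fun t ht h => ?_, fun τ hτ => ?_⟩
  · rw [← hconst ⟨t, ht⟩]
    simp only [g]
    rw [dif_neg h.2]
  · subst hτ
    have hmem : D.pt τ.lo τ.s ∈ D.underSet := ⟨τ, rfl⟩
    have ht : τ.s ∈ Icc (0 : ℝ) 1 := Ico_subset_Icc_self τ.hs
    -- At `τ.s` itself `g` refers to a chosen crossing, so the value is read off just after `τ.s`,
    -- where `g` is given by an arc.
    have ev := τ.eventually_lower (P := fun a => k a = k τ.sourceArc) rfl (hk τ).symm
    have hI : ∀ᶠ t in 𝓝[>] τ.s, t ∈ Icc (0 : ℝ) 1 := by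
      filter_upwards [Ioo_mem_nhdsGT τ.hs.2] with t ht
      exact ⟨τ.hs.1.trans ht.1.le, ht.2.le⟩
    obtain ⟨t, ⟨h1, h2⟩, h3⟩ :=
      ((ev.filter_mono (nhdsWithin_mono τ.s fun t (ht : t ∈ Ioi τ.s) => ne_of_gt ht)).and hI).exists
    rw [← h2, ← hconst ⟨t, h3⟩]
    simp only [g]
    rw [dif_neg h1.2]

/-- A function on the arcs that takes the same value on the two lower arcs of each crossing
comes from a function on the components of the link. -/
theorem exists_component_value {A : Type u} {k : D.Arc → A}
    (hk : ∀ τ : D.Crossing, k τ.sourceArc = k τ.targetArc) :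
    ∃ K : Fin D.n → A, (∀ v, K (D.next v) = K v) ∧
      ∀ τ : D.Crossing, k τ.sourceArc = K τ.lo ∧ k τ.overArc = K τ.up := by
  choose K hK hKs using exists_edge_value hk
  refine ⟨K, fun v => ?_, fun τ => ⟨hKs _ τ rfl, hK _ _ (Ico_subset_Icc_self τ.ht) τ.overPt_mem⟩⟩
  -- Consecutive edges share a vertex. It is not a lower point, so it lies on an arc and both edge
  -- values are the value of that arc.
  have hp : D.pt (D.next v) 0 = D.pt v 1 := by simp [pt]
  have hmem : D.pt (D.next v) 0 ∈ D.carrier \ D.underSet := by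
    refine ⟨pt_mem_carrier _ (by simp), ?_⟩
    rintro ⟨τ, hτ⟩
    have hv : D.vert (D.next v) = D.pt τ.lo τ.s := by
      refine Eq.trans ?_ hτ.symm
      simp [pt]
    have h1 := D.vertex_simple _ _ _ τ.hs (congrArg Prod.fst hv)
    have h2 := D.vertex_simple _ _ _ τ.ht ((congrArg Prod.fst hv).trans τ.meet)
    exact τ.ne ⟨h1.1.symm.trans h2.1, h1.2.trans h2.2.symm⟩
  rw [← hK _ 0 (by simp) hmem, ← hK v 1 (by simp) (hp ▸ hmem)]
  congr 2
  exact Subtype.ext hp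

end LinkDiagram
end QuandleLink

/-! ### Evaluation of the shifted cocycle on the fundamental cycle. -/

namespace QuandleLink

theorem boundary0_gen_one {X : Type u} {Y : Type v} (y : Y) (x : Fin (1 + 1) → X) :
    boundary0 X Y 1 (QuandleChain.gen y x) =
      QuandleChain.gen y ![x 0] - QuandleChain.gen y ![x 1] := by
  have h0 : face0 (n := 1) 0 (y, x) = (y, ![x 1]) := Prod.ext rfl (by ext j; fin_cases j; rfl)
  have h1 : face0 (n := 1) 1 (y, x) = (y, ![x 0]) := Prod.ext rfl (by ext j; fin_cases j; rfl)
  simp only [boundary0, QuandleChain.gen, Submodule.mapQ_apply, rackBoundary0,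
    Finsupp.linearCombination_single, one_smul, ← Submodule.Quotient.mk_sub]
  congr 1
  rw [Fin.sum_univ_two, h0, h1]
  simp [sub_eq_add_neg, add_comm]

theorem boundary1_gen_one {X : Type u} [Quandle X] {Y : Type v} [MulAction (AssocGroup X)ᵐᵒᵖ Y]
    (y : Y) (x : Fin (1 + 1) → X) :
    boundary1 X Y 1 (QuandleChain.gen y x) =
      QuandleChain.gen (op (toAs (x 1)) • y) ![x 1 ◃ x 0] -
        QuandleChain.gen (op (toAs (x 0)) • y) ![x 1] := by
  have h0 : face1 (n := 1) 0 (y, x) = (op (toAs (x 0)) • y, ![x 1]) :=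
    Prod.ext rfl (by ext j; fin_cases j; rfl)
  have h1 : face1 (n := 1) 1 (y, x) = (op (toAs (x 1)) • y, ![x 1 ◃ x 0]) :=
    Prod.ext rfl (by ext j; fin_cases j; rfl)
  simp only [boundary1, QuandleChain.gen, Submodule.mapQ_apply, rackBoundary1,
    Finsupp.linearCombination_single, one_smul, ← Submodule.Quotient.mk_sub]
  congr 1
  rw [Fin.sum_univ_two, h0, h1]
  simp [sub_eq_add_neg, add_comm]

theorem chainMap_gen {Q : Type u} {X : Type v} {Y Z : Type*} (p : Y → Z) (f : Q → X) {n : ℕ}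
    (y : Y) (x : Fin n → Q) :
    chainMap p f n (QuandleChain.gen y x) = QuandleChain.gen (p y) fun i => f (x i) := by
  refine (Submodule.mapQ_apply _ _ _ _).trans (congrArg Submodule.Quotient.mk ?_)
  simp

section Cocycle

variable {X : Type u} {A : Type w} [AddCommGroup A]

/-- The function `X → A` of a `1`-cochain. -/
noncomputable def cochainValue (κ : QuandleCochain X PUnit.{1} A 1) (x : X) : A :=
  κ (QuandleChain.gen PUnit.unit ![x])

/-- The cocycle condition on `(x, y)` reads `κ(x) - κ(y) - (κ(x * y) - κ(y)) = 0`; the point of a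
one-point `X`-set does not move, so the terms in `y` cancel. -/
theorem IsCocycle.cochainValue_act [Quandle X] {κ : QuandleCochain X PUnit.{1} A 1}
    (hκ : IsCocycle κ) (x y : X) : cochainValue κ (y ◃ x) = cochainValue κ x := by
  have h := LinearMap.congr_fun hκ (QuandleChain.gen PUnit.unit ![x, y])
  simp only [LinearMap.comp_apply, boundary, LinearMap.sub_apply, boundary0_gen_one,
    boundary1_gen_one, LinearMap.zero_apply, map_sub] at h
  simp only [Matrix.cons_val_zero, Matrix.cons_val_one] at h
  have h' : cochainValue κ x - cochainValue κ y - (cochainValue κ (y ◃ x) - cochainValue κ y) = 0 :=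
    h
  rw [sub_sub_sub_cancel_right, sub_eq_zero] at h'
  exact h'.symm

theorem coshift_gen (κ : QuandleCochain X PUnit.{1} A 1) (y : PUnit.{1}) (x : Fin 2 → X) :
    coshift κ (QuandleChain.gen y x) = cochainValue κ (x 0) - cochainValue κ (x 1) := by
  simp [coshift, shift, boundary0_gen_one, cochainValue]

end Cocycle

namespace LinkDiagram

variable {D : LinkDiagram}

/-- Each level set of `K` is a sublink, so the symmetry of linking numbers applies to every value of
`K` separately. -/
theorem sum_sign_smul_sub [Fintype D.Crossing] {A : Type w} [AddCommGroup A] {K : Fin D.n → A}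
    (hK : ∀ v, K (D.next v) = K v) :
    ∑ τ : D.Crossing, τ.sign • (K τ.lo - K τ.up) = 0 := by
  classical
  have key : ∀ f : D.Crossing → Fin D.n, ∑ τ : D.Crossing, τ.sign • K (f τ) =
      ∑ a ∈ Finset.univ.image K, (∑ τ : D.Crossing with f τ ∈ K ⁻¹' {a}, τ.sign) • a := by
    intro f
    simp only [Finset.sum_smul, Finset.sum_filter, ite_smul, zero_smul, mem_preimage,
      mem_singleton_iff]
    rw [Finset.sum_comm]
    refine Finset.sum_congr rfl fun τ _ => ?_
    rw [Finset.sum_ite_eq, if_pos (Finset.mem_image_of_mem _ (Finset.mem_univ _))]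
  simp only [smul_sub, Finset.sum_sub_distrib]
  rw [key, key, sub_eq_zero]
  refine Finset.sum_congr rfl fun a _ => ?_
  congr 1
  convert sum_sign_lo_eq_sum_sign_up (C := K ⁻¹' {a}) (by simp [hK])

/-- The crossing relation expresses the target arc as the source arc acted on by the upper arc, and
`κ` is blind to this action. -/
theorem source_act_cochainValue {X : Type u} [Quandle X] {A : Type w} [AddCommGroup A]
    {κ : QuandleCochain X PUnit.{1} A 1} (hκ : IsCocycle κ) (c : D.FundQuandle →◃ X)
    (τ : D.Crossing) : cochainValue κ (c (D.arcElt τ.sourceArc)) =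
      cochainValue κ (c (D.arcElt τ.targetArc)) := by
  have h : D.arcElt τ.overArc ◃ D.arcElt τ.sourceArc = D.arcElt τ.targetArc :=
    Quotient.sound (QTerm.Rel.of_rel (CrossingRel.mk τ))
  rw [← h, ShelfHom.map_act, hκ.cochainValue_act]

theorem coshift_fundCycle {X : Type u} [Quandle X] {A : Type w} [AddCommGroup A]
    {κ : QuandleCochain X PUnit.{1} A 1} (hκ : IsCocycle κ) (c : D.FundQuandle →◃ X) :
    coshift κ (orbitChainMap PUnit.unit 2 (homChainMap c 2 D.fundCycle)) = 0 := by
  have := Fintype.ofFinite D.Crossing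
  obtain ⟨K, hK, hKτ⟩ := exists_component_value
    (k := fun a => cochainValue κ (c (D.arcElt a))) (source_act_cochainValue hκ c)
  rw [fundCycle, finsum_eq_sum_of_fintype, map_sum, map_sum, map_sum, ← sum_sign_smul_sub hK]
  refine Finset.sum_congr rfl fun τ _ => ?_
  rw [weight, map_smul, map_smul, map_smul, homChainMap, orbitChainMap, chainMap_gen,
    chainMap_gen, coshift_gen, ← (hKτ τ).1, ← (hKτ τ).2]
  rfl

end LinkDiagram

end QuandleLink

theorem mainTheorem4 {X : Type u} [Quandle X] [Finite X] {A : Type v} [AddCommGroup A]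
    (L : QuandleLink.OrientedLink) (D : QuandleLink.LinkDiagram) (hD : D.Represents L)
    (κ : QuandleLink.QuandleCochain X PUnit.{1} A 1) (hκ : QuandleLink.IsCocycle κ) :
    D.cocycleInvariant (QuandleLink.coshift κ) =
      (D.coloringNumber X : ℤ) • AddMonoidAlgebra.single (0 : A) (1 : ℤ) := by
  -- Since `X` is finite there are finitely many colourings, so the `finsum` is an honest sum and
  -- not the default value `0`.
  have := Fintype.ofFinite (D.FundQuandle →◃ X)
  simp only [QuandleLink.LinkDiagram.cocycleInvariant,
    QuandleLink.LinkDiagram.generalizedInvariant,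
    QuandleLink.LinkDiagram.coshift_fundCycle hκ]
  rw [finsum_eq_sum_of_fintype, Finset.sum_const, Finset.card_univ,
    QuandleLink.LinkDiagram.coloringNumber, Nat.card_eq_fintype_card, natCast_zsmul]
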